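/- Let $\mathbb{D}=\{z\in\mathbb{C}:|z|<1\}$. Let $\phi$ be a Ma–Minda function: $\phi$ is analytic and univalent in $\mathbb{D}$ with positive real part, $\phi(\mathbb{D})$ is symmetric with respect to the real axis and starlike with respect to $\phi(0)=1$, and $\phi'(0)>0$. Write $\phi(z)=1+\sum_{n\ge1}B_nz^n$, and suppose that $B_n>0$ for all $n\ge1$ and that $\phi$ lies in the Hardy class $H^2$. Let $\mathcal{S}$ be the class of univalent analytic functions $f$ in $\mathbb{D}$ with $f(0)=0$ and $f'(0)=1$. Let $\mathcal{S}^*(\phi)$ be the class of all $f\in\mathcal{S}$ with $zf'(z)/f(z)\prec\phi(z)$, that is, $zf'(z)/f(z)=\phi(\omega(z))$ in $\mathbb{D}$ for some analytic $\omega:\mathbb{D}\to\mathbb{D}$ with $\omega(0)=0$ (the left side being $1$ at $z=0$). **Theorem 2.1.** There is a unique function $h\in\mathcal{S}$ with $zh'(z)/h(z)=\phi(z)$ in $\mathbb{D}$; the limit $h(-1):=\lim_{r\to1^-}h(-r)$ exists and is finite; and the equation $h(r)+h(-1)=0$ has a smallest root $r_f$ in $(0,1)$. Every $f(z)=z+\sum_{n\ge2}a_nz^n$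 in $\mathcal{S}^*(\phi)$ satisfies $$r+\sum_{n=2}^{\infty}|a_n|r^n\le d\bigl(f(0),\partial f(\mathbb{D})\bigr)\qquad\text{for } 0\le r\le\min\{r_f,1/3\},$$ where $d$ is the Euclidean distance. If $r_f\le 1/3$, then the radius $r_f$ is best possible: for every $r\in(r_f,1)$ there is an $f(z)=z+\sum_{n\ge2}a_nz^n$ in $\mathcal{S}^*(\phi)$ with $r+\sum_{n\ge2}|a_n|r^n>d(f(0),\partial f(\mathbb{D}))$. -/

import Mathlib

open Filter Topology

namespace MaMinda

/-- The open unit disk of the complex plane. -/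
def disk : Set ℂ := Metric.ball 0 1

/-- The `n`-th Taylor coefficient of `f` at the origin. -/
noncomputable def taylorCoeff (f : ℂ → ℂ) (n : ℕ) : ℂ :=
  iteratedDeriv n f 0 / (n.factorial : ℂ)

/-- Normalized univalent functions: analytic and injective on the disk, with
`f 0 = 0` and `f' 0 = 1`. -/
structure IsClassS (f : ℂ → ℂ) : Prop where
  analytic : DifferentiableOn ℂ f disk
  map_zero : f 0 = 0
  deriv_zero : deriv f 0 = 1
  univalent : Set.InjOn f disk

/-- Subordination `f ≺ g` in the disk: `f = g ∘ ω` on the disk for some analytic self-map `ω` of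
the disk that fixes the origin. -/
def Subordinate (f g : ℂ → ℂ) : Prop :=
  ∃ ω : ℂ → ℂ, DifferentiableOn ℂ ω disk ∧ Set.MapsTo ω disk disk ∧ ω 0 = 0 ∧
    ∀ z ∈ disk, f z = g (ω z)

/-- Ma-Minda functions: analytic and univalent on the disk, with positive real part, and with an
image that is symmetric about the real axis and starlike with respect to `φ 0 = 1`; moreover
`φ' 0` is a positive real number. -/
structure IsMaMinda (φ : ℂ → ℂ) : Prop where
  analytic : DifferentiableOn ℂ φ disk
  univalent : Set.InjOn φ disk
  re_pos : ∀ z ∈ disk, 0 < (φ z).re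
  symmetric : ∀ w ∈ φ '' disk, (starRingEnd ℂ) w ∈ φ '' disk
  starlike : StarConvex ℝ (1 : ℂ) (φ '' disk)
  map_zero : φ 0 = 1
  deriv_zero_re : 0 < (deriv φ 0).re
  deriv_zero_im : (deriv φ 0).im = 0

/-- The function `z f'(z) / f(z)`, with its removable singularity at the origin filled in
(the value there is `1` for a normalized univalent `f`). -/
noncomputable def logDerivQuotient (f : ℂ → ℂ) (z : ℂ) : ℂ :=
  if z = 0 then 1 else z * deriv f z / f z

/-- The Ma-Minda starlike class associated with `φ`. -/
def StarlikeClass (φ : ℂ → ℂ) : Set (ℂ → ℂ) :=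
  {f | IsClassS f ∧ Subordinate (logDerivQuotient f) φ}

/-- The Ma-Minda extremal function of the starlike class: the normalized univalent function `h`
with `z h'(z) / h(z) = φ z` on the disk. -/
def IsExtremal (φ h : ℂ → ℂ) : Prop :=
  IsClassS h ∧ ∀ z ∈ disk, logDerivQuotient h z = φ z

/-- The Hardy class `H²` of the disk: analytic functions whose square means over the circles
`|z| = r < 1` are bounded. -/
def MemHardyTwo (φ : ℂ → ℂ) : Prop :=
  DifferentiableOn ℂ φ disk ∧
    ∃ C : ℝ, ∀ r : ℝ, 0 ≤ r → r < 1 → Real.circleAverage (fun z => ‖φ z‖ ^ 2) 0 r ≤ C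

/-- The terms `|a_n| r ^ n`, `n ≥ 2`, indexed from zero. -/
noncomputable def majorantTerm (f : ℂ → ℂ) (r : ℝ) (n : ℕ) : ℝ :=
  ‖taylorCoeff f (n + 2)‖ * r ^ (n + 2)

/-- The Euclidean distance from `f 0` to the boundary of the image of the disk. -/
noncomputable def boundaryDist (f : ℂ → ℂ) : ℝ :=
  Metric.infDist (f 0) (frontier (f '' disk))

end MaMinda

/-!
Every `f` in the class is `z exp (q z)` with `z q' = φ ∘ ω - 1` for a Schwarz function `ω`, and the
extremal function is `h z = z exp (Q z)` with `z Q' = φ - 1`. For Schwarz functions, Bohr's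
inequality on `[0, 1/3]` passes to `φ ∘ ω`, so the majorant series of `q'` is at most `Q'` there,
and Grönwall's inequality bounds the majorant series of `f` by `h r`. As the Taylor coefficients of
the univalent function `φ` are nonnegative, `φ` is real and increasing on `(-1, 1)` and nonreal
elsewhere; hence at a minimum of `Re q z - Q (-‖z‖)` the derivatives can be compared, and
`Q (-‖z‖) ≤ Re q z`. Therefore `-h(-1) ≤ d(0, ∂f(𝔻))`, with equality for `f = h`, and the Bohr
radius is where the increasing function `h r` reaches `-h(-1)`.
-/

namespace MaMinda

open scoped ComplexOrder ComplexConjugate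

lemma isOpen_disk : IsOpen disk := Metric.isOpen_ball

lemma mem_disk {z : ℂ} : z ∈ disk ↔ ‖z‖ < 1 := mem_ball_zero_iff

lemma zero_mem_disk : (0 : ℂ) ∈ disk := Metric.mem_ball_self one_pos

lemma disk_mem_nhds {z : ℂ} (hz : z ∈ disk) : disk ∈ 𝓝 z := isOpen_disk.mem_nhds hz

lemma closedBall_subset_disk {ρ : ℝ} (hρ : ρ < 1) : Metric.closedBall 0 ρ ⊆ disk :=
  Metric.closedBall_subset_ball hρ

lemma ofReal_mem_disk {x : ℝ} (hx : x ∈ Set.Ioo (-1 : ℝ) 1) : (x : ℂ) ∈ disk := by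
  rw [mem_disk, Complex.norm_real, Real.norm_eq_abs]
  exact abs_lt.2 hx

lemma neg_norm_mem_Ioo {z : ℂ} (hz : z ∈ disk) : -‖z‖ ∈ Set.Ioo (-1 : ℝ) 1 :=
  ⟨neg_lt_neg (mem_disk.1 hz), by linarith [norm_nonneg z]⟩

/-! ### Taylor coefficients -/

section

variable {f g : ℂ → ℂ}

lemma analyticAt_of_mem_disk (hf : DifferentiableOn ℂ f disk) {z : ℂ} (hz : z ∈ disk) :
    AnalyticAt ℂ f z :=
  hf.analyticAt (disk_mem_nhds hz)

lemma hasDerivAt_of_mem_disk (hf : DifferentiableOn ℂ f disk) {z : ℂ} (hz : z ∈ disk) :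
    HasDerivAt f (deriv f z) z :=
  (hf.differentiableAt (disk_mem_nhds hz)).hasDerivAt

lemma differentiableOn_dslope_disk (hf : DifferentiableOn ℂ f disk) :
    DifferentiableOn ℂ (dslope f 0) disk :=
  (Complex.differentiableOn_dslope (disk_mem_nhds zero_mem_disk)).2 hf

lemma eq_add_mul_dslope (f : ℂ → ℂ) (z : ℂ) : f z = f 0 + z * dslope f 0 z := by
  have h := sub_smul_dslope f 0 z
  rw [sub_zero, smul_eq_mul] at h
  rw [h, add_sub_cancel]

lemma taylorCoeff_zero (f : ℂ → ℂ) : taylorCoeff f 0 = f 0 := by simp [taylorCoeff]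

lemma taylorCoeff_congr_of_eqOn (h : Set.EqOn f g disk) (n : ℕ) :
    taylorCoeff f n = taylorCoeff g n := by
  rw [taylorCoeff, taylorCoeff,
    (h.eventuallyEq_of_mem (disk_mem_nhds zero_mem_disk)).iteratedDeriv_eq n]

lemma hasSum_taylorCoeff (hf : DifferentiableOn ℂ f disk) {z : ℂ} (hz : z ∈ disk) :
    HasSum (fun n => taylorCoeff f n * z ^ n) (f z) := by
  refine (Complex.hasSum_taylorSeries_on_ball hf hz).congr_fun fun n => ?_
  simp only [taylorCoeff, sub_zero, smul_eq_mul]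
  ring

lemma taylorCoeff_mul (hf : AnalyticAt ℂ f 0) (hg : AnalyticAt ℂ g 0) (n : ℕ) :
    taylorCoeff (fun z => f z * g z) n =
      ∑ i ∈ Finset.range (n + 1), taylorCoeff f i * taylorCoeff g (n - i) := by
  simp only [taylorCoeff]
  rw [iteratedDeriv_fun_mul hf.contDiffAt hg.contDiffAt, Finset.sum_div]
  refine Finset.sum_congr rfl fun i hi => ?_
  rw [Nat.cast_choose ℂ (Finset.mem_range_succ_iff.1 hi)]
  have hn : (n.factorial : ℂ) ≠ 0 := mod_cast n.factorial_ne_zero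
  field_simp

lemma taylorCoeff_deriv (f : ℂ → ℂ) (n : ℕ) :
    taylorCoeff (deriv f) n = (n + 1) * taylorCoeff f (n + 1) := by
  have hn : (n : ℂ) + 1 ≠ 0 := mod_cast n.succ_ne_zero
  simp only [taylorCoeff, iteratedDeriv_succ', Nat.factorial_succ, Nat.cast_mul, Nat.cast_succ]
  field_simp

lemma taylorCoeff_id (n : ℕ) : taylorCoeff (fun z => z) n = if n = 1 then 1 else 0 := by
  rcases n with _ | _ | n
  · simp [taylorCoeff]
  · simp [taylorCoeff]
  · simp [taylorCoeff, iteratedDeriv_succ', deriv_id'']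

lemma taylorCoeff_id_mul (hg : AnalyticAt ℂ g 0) (n : ℕ) :
    taylorCoeff (fun z => z * g z) (n + 1) = taylorCoeff g n := by
  rw [taylorCoeff_mul (f := fun z => z) analyticAt_id hg,
    Finset.sum_eq_single_of_mem 1 (by simp) fun i _ hi => by
      rw [taylorCoeff_id, if_neg hi, zero_mul],
    taylorCoeff_id, if_pos rfl, one_mul, Nat.add_sub_cancel]

lemma taylorCoeff_const_add_succ (c : ℂ) (g : ℂ → ℂ) (n : ℕ) :
    taylorCoeff (fun z => c + g z) (n + 1) = taylorCoeff g (n + 1) := by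
  simp only [taylorCoeff, iteratedDeriv_succ', funext fun z => deriv_const_add (f := g) (x := z) c]

lemma taylorCoeff_const_mul (c : ℂ) (f : ℂ → ℂ) (n : ℕ) :
    taylorCoeff (fun z => c * f z) n = c * taylorCoeff f n := by
  rw [taylorCoeff, iteratedDeriv_const_mul_field, taylorCoeff, mul_div_assoc]

end

/-! ### Coefficient bounds -/

section

variable {f : ℂ → ℂ} {ρ : ℝ} {n : ℕ}

lemma norm_circleAverage_le {E : Type*} [NormedAddCommGroup E] [NormedSpace ℝ E] (f : ℂ → E)
    (c : ℂ) (R : ℝ) :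
    ‖Real.circleAverage f c R‖ ≤ Real.circleAverage (fun z => ‖f z‖) c R := by
  rw [Real.circleAverage_def, Real.circleAverage_def, norm_smul,
    Real.norm_of_nonneg (by positivity), smul_eq_mul]
  gcongr
  exact intervalIntegral.norm_integral_le_integral_norm (by positivity)

lemma circleAverage_inv_pow_mul (hf : DifferentiableOn ℂ f disk) (hρ0 : 0 < ρ) (hρ1 : ρ < 1)
    (n : ℕ) : Real.circleAverage (fun z => (z ^ n)⁻¹ * f z) 0 ρ = taylorCoeff f n := by
  have hd : DiffContOnCl ℂ f (Metric.ball 0 ρ) := by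
    refine DifferentiableOn.diffContOnCl ?_
    rw [closure_ball _ hρ0.ne']
    exact hf.mono (closedBall_subset_disk hρ1)
  have hcauchy := hd.circleIntegral_one_div_sub_center_pow_smul hρ0 n
  calc Real.circleAverage (fun z => (z ^ n)⁻¹ * f z) 0 ρ
      = (2 * Real.pi * Complex.I)⁻¹ • ∮ z in C(0, ρ), (1 / (z - 0) ^ (n + 1)) • f z := by
        rw [Real.circleAverage_eq_circleIntegral hρ0.ne']
        congr 2
        ext z
        simp only [sub_zero, smul_eq_mul, one_div, pow_succ, mul_inv]
        ring
    _ = taylorCoeff f n := by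
        rw [hcauchy, taylorCoeff]
        simp only [smul_eq_mul]
        field_simp

lemma circleAverage_pow_mul (hf : DifferentiableOn ℂ f disk) (hρ0 : 0 < ρ) (hρ1 : ρ < 1)
    (hn : n ≠ 0) : Real.circleAverage (fun z => z ^ n * f z) 0 ρ = 0 := by
  have hd : DiffContOnCl ℂ (fun z => z ^ n * f z) (Metric.ball 0 |ρ|) := by
    refine DifferentiableOn.diffContOnCl ?_
    rw [abs_of_pos hρ0, closure_ball _ hρ0.ne']
    exact (differentiable_id.pow n).differentiableOn.mul (hf.mono (closedBall_subset_disk hρ1))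
  rw [hd.circleAverage, zero_pow hn, zero_mul]

lemma circleAverage_inv_pow_mul_conj (hf : DifferentiableOn ℂ f disk) (hρ0 : 0 < ρ) (hρ1 : ρ < 1)
    (hn : n ≠ 0) : Real.circleAverage (fun z => (z ^ n)⁻¹ * conj (f z)) 0 ρ = 0 := by
  have hρ : (ρ : ℂ) ≠ 0 := mod_cast hρ0.ne'
  have hcont : ContinuousOn f (Metric.sphere 0 ρ) := hf.continuousOn.mono
    (Metric.sphere_subset_closedBall.trans (closedBall_subset_disk hρ1))
  have hconj : Set.EqOn (fun z => (z ^ n)⁻¹ * conj (f z))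
      (fun z => ((ρ : ℂ) ^ (2 * n))⁻¹ • conj (z ^ n * f z)) (Metric.sphere 0 |ρ|) := by
    intro z hz
    have hz : z * conj z = ρ ^ 2 := by
      rw [Complex.mul_conj, Complex.normSq_eq_norm_sq, mem_sphere_zero_iff_norm.1 hz, sq_abs,
        Complex.ofReal_pow]
    have hz0 : z ≠ 0 := by
      rintro rfl
      exact pow_ne_zero 2 hρ (by rw [← hz, zero_mul])
    simp only [map_mul, map_pow, pow_mul, ← hz, mul_pow, smul_eq_mul]
    have : conj z ≠ 0 := (map_ne_zero _).2 hz0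
    field_simp
  have hint : CircleIntegrable (fun z => z ^ n * f z) 0 ρ :=
    ((continuous_pow n).continuousOn.mul hcont).circleIntegrable hρ0.le
  have havg : Real.circleAverage (fun z => conj (z ^ n * f z)) 0 ρ = 0 := by
    simpa [Function.comp_def, circleAverage_pow_mul hf hρ0 hρ1 hn] using
      (Complex.conjCLE : ℂ →L[ℝ] ℂ).circleAverage_comp_comm hint
  rw [Real.circleAverage_congr_sphere hconj, Real.circleAverage_fun_smul, havg, smul_zero]

lemma circleAverage_inv_pow_mul_re (hf : DifferentiableOn ℂ f disk) (hρ0 : 0 < ρ) (hρ1 : ρ < 1)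
    (hn : n ≠ 0) :
    Real.circleAverage (fun z => (z ^ n)⁻¹ * ((2 * (f z).re : ℝ) : ℂ)) 0 ρ = taylorCoeff f n := by
  have hcont : ContinuousOn f (Metric.sphere 0 ρ) := hf.continuousOn.mono
    (Metric.sphere_subset_closedBall.trans (closedBall_subset_disk hρ1))
  have hinv : ContinuousOn (fun z : ℂ => (z ^ n)⁻¹) (Metric.sphere 0 ρ) :=
    (continuous_pow n).continuousOn.inv₀ fun z hz =>
      pow_ne_zero n (Metric.ne_of_mem_sphere hz hρ0.ne')
  have hconj : ContinuousOn (fun z => conj (f z)) (Metric.sphere 0 ρ) :=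
    Complex.continuous_conj.comp_continuousOn hcont
  simp only [← Complex.add_conj, mul_add]
  rw [Real.circleAverage_fun_add ((hinv.fun_mul hcont).circleIntegrable hρ0.le)
    ((hinv.fun_mul hconj).circleIntegrable hρ0.le), circleAverage_inv_pow_mul hf hρ0 hρ1,
    circleAverage_inv_pow_mul_conj hf hρ0 hρ1 hn, add_zero]

lemma circleAverage_re (hf : DifferentiableOn ℂ f disk) (hρ0 : 0 < ρ) (hρ1 : ρ < 1) :
    Real.circleAverage (fun z => (f z).re) 0 ρ = (f 0).re := by
  have hint : CircleIntegrable f 0 ρ := (hf.continuousOn.mono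
    (Metric.sphere_subset_closedBall.trans (closedBall_subset_disk hρ1))).circleIntegrable hρ0.le
  have hmean := circleAverage_inv_pow_mul hf hρ0 hρ1 0
  simp only [pow_zero, inv_one, one_mul, taylorCoeff_zero] at hmean
  simpa [Function.comp_def, hmean] using Complex.reCLM.circleAverage_comp_comm hint

lemma norm_taylorCoeff_mul_pow_le_of_re_nonneg (hf : DifferentiableOn ℂ f disk)
    (hre : ∀ z ∈ disk, 0 ≤ (f z).re) (hρ0 : 0 < ρ) (hρ1 : ρ < 1) (hn : n ≠ 0) :
    ‖taylorCoeff f n‖ * ρ ^ n ≤ 2 * (f 0).re := by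
  have hnorm : Set.EqOn (fun z => ‖(z ^ n)⁻¹ * ((2 * (f z).re : ℝ) : ℂ)‖)
      (fun z => (2 / ρ ^ n) • (f z).re) (Metric.sphere 0 |ρ|) := by
    intro z hz
    rw [abs_of_pos hρ0, mem_sphere_zero_iff_norm] at hz
    have hre := hre z (mem_disk.2 (hz.trans_lt hρ1))
    simp only [norm_mul, norm_inv, norm_pow, hz, Complex.norm_real, smul_eq_mul,
      Real.norm_of_nonneg (mul_nonneg zero_le_two hre)]
    ring
  have hle := norm_circleAverage_le (fun z => (z ^ n)⁻¹ * ((2 * (f z).re : ℝ) : ℂ)) 0 ρ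
  rw [circleAverage_inv_pow_mul_re hf hρ0 hρ1 hn, Real.circleAverage_congr_sphere hnorm,
    Real.circleAverage_fun_smul, circleAverage_re hf hρ0 hρ1, smul_eq_mul, div_mul_eq_mul_div,
    le_div_iff₀ (by positivity)] at hle
  exact hle

/-- Carathéodory's coefficient bound. -/
lemma norm_taylorCoeff_le_of_re_nonneg (hf : DifferentiableOn ℂ f disk)
    (hre : ∀ z ∈ disk, 0 ≤ (f z).re) (hn : n ≠ 0) : ‖taylorCoeff f n‖ ≤ 2 * (f 0).re := by
  have hlim : Tendsto (fun ρ : ℝ => ‖taylorCoeff f n‖ * ρ ^ n) (𝓝[<] 1)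
      (𝓝 (‖taylorCoeff f n‖ * 1 ^ n)) :=
    ((continuous_pow n).const_mul _).continuousAt.tendsto.mono_left nhdsWithin_le_nhds
  rw [one_pow, mul_one] at hlim
  refine le_of_tendsto hlim ?_
  filter_upwards [Ioo_mem_nhdsLT one_pos] with ρ hρ
  exact norm_taylorCoeff_mul_pow_le_of_re_nonneg hf hre hρ.1 hρ.2 hn

lemma norm_taylorCoeff_le_of_norm_le_one (hf : DifferentiableOn ℂ f disk)
    (hle : ∀ z ∈ disk, ‖f z‖ ≤ 1) (hn : n ≠ 0) : ‖taylorCoeff f n‖ ≤ 2 * (1 - ‖f 0‖) := by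
  obtain ⟨c, hc, hcf⟩ : ∃ c : ℂ, ‖c‖ = 1 ∧ -c * f 0 = (‖f 0‖ : ℂ) := by
    rcases eq_or_ne (f 0) 0 with h0 | h0
    · exact ⟨1, by simp, by simp [h0]⟩
    · exact ⟨-(‖f 0‖ / f 0), by simp [h0], by rw [neg_neg, div_mul_cancel₀ _ h0]⟩
  have hre : ∀ z ∈ disk, 0 ≤ (1 + c * f z).re := by
    intro z hz
    have := (abs_le.1 ((Complex.abs_re_le_norm (c * f z)).trans_eq
      (by rw [norm_mul, hc, one_mul]))).1
    rw [Complex.add_re, Complex.one_re]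
    linarith [hle z hz]
  obtain ⟨k, rfl⟩ := Nat.exists_eq_succ_of_ne_zero hn
  have hcoeff := norm_taylorCoeff_le_of_re_nonneg ((hf.const_mul c).const_add 1) hre hn
  rw [taylorCoeff_const_add_succ, taylorCoeff_const_mul, norm_mul, hc, one_mul] at hcoeff
  rw [neg_mul, neg_eq_iff_eq_neg] at hcf
  simpa [hcf, sub_eq_add_neg] using hcoeff

end

/-! ### Majorant series -/

/-- A Schwarz function: an analytic self-map of the disk that fixes the origin. -/
structure IsSchwarz (ω : ℂ → ℂ) : Prop where
  differentiableOn : DifferentiableOn ℂ ω disk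
  mapsTo : Set.MapsTo ω disk disk
  map_zero : ω 0 = 0

namespace IsSchwarz

variable {ω : ℂ → ℂ}

lemma id : IsSchwarz fun z => z := ⟨differentiableOn_id, Set.mapsTo_id _, rfl⟩

lemma norm_le (hω : IsSchwarz ω) {z : ℂ} (hz : z ∈ disk) : ‖ω z‖ ≤ ‖z‖ :=
  Complex.norm_le_norm_of_mapsTo_ball hω.differentiableOn
    (hω.mapsTo.mono_right Metric.ball_subset_closedBall) hω.map_zero (mem_disk.1 hz)

lemma norm_dslope_le_one (hω : IsSchwarz ω) {z : ℂ} (hz : z ∈ disk) : ‖dslope ω 0 z‖ ≤ 1 := by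
  have hmaps : Set.MapsTo ω (Metric.ball 0 1) (Metric.closedBall (ω 0) 1) := by
    rw [hω.map_zero]
    exact hω.mapsTo.mono_right Metric.ball_subset_closedBall
  simpa using Complex.norm_dslope_le_div_of_mapsTo_ball hω.differentiableOn hmaps hz

lemma comp_eq_add_mul (hω : IsSchwarz ω) (g : ℂ → ℂ) (z : ℂ) :
    g (ω z) = g 0 + z * (dslope ω 0 z * dslope g 0 (ω z)) := by
  have hωz := eq_add_mul_dslope ω z
  rw [hω.map_zero, zero_add] at hωz
  rw [← mul_assoc, ← hωz]
  exact eq_add_mul_dslope g (ω z)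

end IsSchwarz

/-- The partial sums `∑_{k < N} |a_k| r ^ k` of the majorant series of `f`. -/
noncomputable def majorantSum (f : ℂ → ℂ) (r : ℝ) (N : ℕ) : ℝ :=
  ∑ k ∈ Finset.range N, ‖taylorCoeff f k‖ * r ^ k

section

variable {f g : ℂ → ℂ} {r : ℝ}

lemma majorantSum_nonneg (f : ℂ → ℂ) (hr : 0 ≤ r) (N : ℕ) : 0 ≤ majorantSum f r N :=
  Finset.sum_nonneg fun _ _ => by positivity

lemma majorantSum_mono (f : ℂ → ℂ) (hr : 0 ≤ r) : Monotone (majorantSum f r) := fun _ _ hMN =>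
  Finset.sum_le_sum_of_subset_of_nonneg (Finset.range_mono hMN) fun _ _ _ => by positivity

lemma majorantSum_congr (h : Set.EqOn f g disk) (r : ℝ) (N : ℕ) :
    majorantSum f r N = majorantSum g r N := by
  simp only [majorantSum, taylorCoeff_congr_of_eqOn h]

lemma majorantSum_const_add_id_mul (c : ℂ) (hg : AnalyticAt ℂ g 0) (r : ℝ) (N : ℕ) :
    majorantSum (fun z => c + z * g z) r (N + 1) = ‖c‖ + r * majorantSum g r N := by
  rw [majorantSum, Finset.sum_range_succ', taylorCoeff_zero, zero_mul, add_zero, pow_zero, mul_one,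
    add_comm, majorantSum, Finset.mul_sum]
  congr 1
  refine Finset.sum_congr rfl fun k _ => ?_
  rw [taylorCoeff_const_add_succ, taylorCoeff_id_mul hg]
  ring

lemma sum_range_sum_mul_le {R : Type*} [CommSemiring R] [PartialOrder R] [IsOrderedRing R]
    {a b : ℕ → R} (ha : ∀ n, 0 ≤ a n) (hb : ∀ n, 0 ≤ b n) (N : ℕ) :
    ∑ n ∈ Finset.range N, ∑ i ∈ Finset.range (n + 1), a i * b (n - i) ≤
      (∑ n ∈ Finset.range N, a n) * ∑ n ∈ Finset.range N, b n := by
  rw [Finset.sum_range_diag_flip N fun i j => a i * b j, Finset.sum_mul_sum]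
  gcongr with i
  · exact fun j _ _ => mul_nonneg (ha i) (hb j)
  · exact Nat.sub_le _ _

lemma majorantSum_mul_le (hf : AnalyticAt ℂ f 0) (hg : AnalyticAt ℂ g 0) (hr : 0 ≤ r) (N : ℕ) :
    majorantSum (fun z => f z * g z) r N ≤ majorantSum f r N * majorantSum g r N := by
  refine le_trans ?_ (sum_range_sum_mul_le (fun n => by positivity) (fun n => by positivity) N)
  refine Finset.sum_le_sum fun n _ => ?_
  calc ‖taylorCoeff (fun z => f z * g z) n‖ * r ^ n
      ≤ (∑ i ∈ Finset.range (n + 1), ‖taylorCoeff f i * taylorCoeff g (n - i)‖) * r ^ n := by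
        rw [taylorCoeff_mul hf hg]
        gcongr
        exact norm_sum_le _ _
    _ = ∑ i ∈ Finset.range (n + 1),
          ‖taylorCoeff f i‖ * r ^ i * (‖taylorCoeff g (n - i)‖ * r ^ (n - i)) := by
        rw [Finset.sum_mul]
        refine Finset.sum_congr rfl fun i hi => ?_
        rw [norm_mul, mul_mul_mul_comm, ← pow_add,
          Nat.add_sub_cancel' (Finset.mem_range_succ_iff.1 hi)]

lemma mul_geom_sum_le_half (hr0 : 0 ≤ r) (hr3 : r ≤ 1 / 3) (N : ℕ) :
    r * ∑ k ∈ Finset.range N, r ^ k ≤ 1 / 2 := by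
  have hgeom : ∑ k ∈ Finset.range N, r ^ k ≤ (1 - r)⁻¹ := by
    rw [← tsum_geometric_of_lt_one hr0 (by linarith)]
    exact (summable_geometric_of_lt_one hr0 (by linarith)).sum_le_tsum _ fun _ _ => by positivity
  refine (mul_le_mul_of_nonneg_left hgeom hr0).trans ?_
  rw [← div_eq_mul_inv, div_le_iff₀ (by linarith)]
  linarith

/-- Bohr's inequality. -/
lemma majorantSum_le_one (hf : DifferentiableOn ℂ f disk) (hle : ∀ z ∈ disk, ‖f z‖ ≤ 1)
    (hr0 : 0 ≤ r) (hr3 : r ≤ 1 / 3) (N : ℕ) : majorantSum f r N ≤ 1 := by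
  rcases N with _ | N
  · simp [majorantSum]
  have h0 : 0 ≤ 1 - ‖f 0‖ := sub_nonneg.2 (hle 0 zero_mem_disk)
  calc majorantSum f r (N + 1)
      = ‖f 0‖ + ∑ k ∈ Finset.range N, ‖taylorCoeff f (k + 1)‖ * r ^ (k + 1) := by
        rw [majorantSum, Finset.sum_range_succ', taylorCoeff_zero, pow_zero, mul_one, add_comm]
    _ ≤ ‖f 0‖ + ∑ k ∈ Finset.range N, 2 * (1 - ‖f 0‖) * r ^ (k + 1) := by
        gcongr with k
        exact norm_taylorCoeff_le_of_norm_le_one hf hle k.succ_ne_zero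
    _ = ‖f 0‖ + 2 * (1 - ‖f 0‖) * (r * ∑ k ∈ Finset.range N, r ^ k) := by
        simp only [Finset.mul_sum, pow_succ']
    _ ≤ ‖f 0‖ + 2 * (1 - ‖f 0‖) * (1 / 2) := by
        gcongr
        exact mul_geom_sum_le_half hr0 hr3 N
    _ = 1 := by ring

lemma majorantSum_comp_le {ω : ℂ → ℂ} (hω : IsSchwarz ω) (hg : DifferentiableOn ℂ g disk)
    (hr0 : 0 ≤ r) (hr3 : r ≤ 1 / 3) (N : ℕ) :
    majorantSum (fun z => g (ω z)) r N ≤ majorantSum g r N := by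
  induction N generalizing g with
  | zero => simp [majorantSum]
  | succ N ih =>
    have hψ := differentiableOn_dslope_disk hω.differentiableOn
    have hk := differentiableOn_dslope_disk hg
    have hψ0 := analyticAt_of_mem_disk hψ zero_mem_disk
    have hkω0 := analyticAt_of_mem_disk (hk.comp hω.differentiableOn hω.mapsTo) zero_mem_disk
    calc majorantSum (fun z => g (ω z)) r (N + 1)
        = ‖g 0‖ + r * majorantSum (fun z => dslope ω 0 z * dslope g 0 (ω z)) r N := by
          rw [funext (hω.comp_eq_add_mul g)]
          exact majorantSum_const_add_id_mul _ (hψ0.mul hkω0) r N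
      _ ≤ ‖g 0‖ + r * (majorantSum (dslope ω 0) r N *
            majorantSum (fun z => dslope g 0 (ω z)) r N) := by
          gcongr
          exact majorantSum_mul_le hψ0 hkω0 hr0 N
      _ ≤ ‖g 0‖ + r * (1 * majorantSum (dslope g 0) r N) := by
          gcongr
          · exact majorantSum_nonneg _ hr0 N
          · exact majorantSum_le_one hψ (fun z hz => hω.norm_dslope_le_one hz) hr0 hr3 N
          · exact ih hk
      _ = majorantSum g r (N + 1) := by
          rw [one_mul, ← majorantSum_const_add_id_mul _ (analyticAt_of_mem_disk hk zero_mem_disk),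
            ← funext (eq_add_mul_dslope g)]

lemma hasDerivAt_majorantSum (f : ℂ → ℂ) (r : ℝ) (N : ℕ) :
    HasDerivAt (fun x => majorantSum f x (N + 1)) (majorantSum (deriv f) r N) r := by
  have hterm : ∀ k ∈ Finset.range (N + 1), HasDerivAt (fun x => ‖taylorCoeff f k‖ * x ^ k)
      (‖taylorCoeff f k‖ * (k * r ^ (k - 1))) r := fun k _ => (hasDerivAt_pow k r).const_mul _
  refine (HasDerivAt.fun_sum hterm).congr_deriv ?_
  rw [Finset.sum_range_succ', Nat.cast_zero, zero_mul, mul_zero, add_zero]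
  refine Finset.sum_congr rfl fun k _ => ?_
  rw [taylorCoeff_deriv, norm_mul, ← Nat.cast_add_one, Complex.norm_natCast, Nat.add_sub_cancel]
  ring

end

/-! ### Functions with a given logarithmic derivative -/

/-- `q` is an exponent of `p` when `z * exp (q z)` is the normalized function on the disk whose
logarithmic derivative quotient `z f'(z) / f(z)` is `p z`. -/
structure IsExponent (p q : ℂ → ℂ) : Prop where
  differentiableOn : DifferentiableOn ℂ q disk
  map_zero : q 0 = 0
  mul_deriv : ∀ z ∈ disk, z * deriv q z = p z - 1

lemma exists_isExponent {p : ℂ → ℂ} (hp : DifferentiableOn ℂ p disk) (hp0 : p 0 = 1) :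
    ∃ q, IsExponent p q := by
  obtain ⟨q, hq0, hq⟩ :=
    ((differentiableOn_dslope_disk hp).isExactOn_ball (c := 0) (r := 1)).with_val_at 0 0
  refine ⟨q, fun z hz => (hq z hz).differentiableAt.differentiableWithinAt, hq0, fun z hz => ?_⟩
  rw [(hq z hz).deriv, eq_add_mul_dslope p z, hp0, add_sub_cancel_left]

namespace IsExponent

variable {f p q : ℂ → ℂ}

lemma apply_zero (hq : IsExponent p q) : p 0 = 1 := by
  rw [← sub_eq_zero, ← hq.mul_deriv 0 zero_mem_disk, zero_mul]

lemma mul_re_deriv_ofReal (hq : IsExponent p q) {x : ℝ} (hx : x ∈ Set.Ioo (-1 : ℝ) 1) :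
    x * (deriv q x).re = (p x).re - 1 := by
  simpa using congrArg Complex.re (hq.mul_deriv x (ofReal_mem_disk hx))

lemma hasDerivAt_mul_exp (hq : IsExponent p q) {z : ℂ} (hz : z ∈ disk) :
    HasDerivAt (fun z => z * Complex.exp (q z)) (p z * Complex.exp (q z)) z := by
  refine ((hasDerivAt_id' z).fun_mul
    (hasDerivAt_of_mem_disk hq.differentiableOn hz).cexp).congr_deriv ?_
  linear_combination Complex.exp (q z) * hq.mul_deriv z hz

lemma deriv_ne_zero (hq : IsExponent p q) (hfq : Set.EqOn f (fun z => z * Complex.exp (q z)) disk)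
    {z : ℂ} (hz : z ∈ disk) (hpz : p z ≠ 0) : deriv f z ≠ 0 := by
  rw [(hfq.eventuallyEq_of_mem (disk_mem_nhds hz)).deriv_eq, (hq.hasDerivAt_mul_exp hz).deriv]
  exact mul_ne_zero hpz (Complex.exp_ne_zero _)

end IsExponent

lemma eq_apply_zero_of_mul_deriv_eq_zero {u : ℂ → ℂ} (hu : DifferentiableOn ℂ u disk)
    (h : ∀ z ∈ disk, z * deriv u z = 0) {z : ℂ} (hz : z ∈ disk) : u z = u 0 := by
  have hne : Set.EqOn (deriv u) 0 (disk ∩ {0}ᶜ) := fun w hw =>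
    (mul_eq_zero.1 (h w hw.1)).resolve_left hw.2
  exact isOpen_disk.is_const_of_deriv_eq_zero Metric.isPreconnected_ball hu
    (hne.of_subset_closure (hu.deriv isOpen_disk).continuousOn continuousOn_const
      Set.inter_subset_left ((dense_compl_singleton 0).open_subset_closure_inter isOpen_disk))
    hz zero_mem_disk

lemma IsExponent.eq_mul_exp {f p q : ℂ → ℂ} (hq : IsExponent p q) (hf : DifferentiableOn ℂ f disk)
    (hf0 : f 0 = 0) (hf1 : deriv f 0 = 1) (hfp : ∀ z ∈ disk, z * deriv f z = p z * f z) {z : ℂ}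
    (hz : z ∈ disk) : f z = z * Complex.exp (q z) := by
  set g := dslope f 0
  have hg : DifferentiableOn ℂ g disk := differentiableOn_dslope_disk hf
  have hfg : f = fun z => z * g z := by
    funext z
    rw [eq_add_mul_dslope f z, hf0, zero_add]
  have hode : ∀ w ∈ disk, w * (deriv g w - deriv q w * g w) = 0 := by
    intro w hw
    have hfd : deriv f w = g w + w * deriv g w := by
      rw [hfg, ((hasDerivAt_id' w).fun_mul (hasDerivAt_of_mem_disk hg hw)).deriv, one_mul]
    have hfw := hfp w hw
    rw [hfd, congrFun hfg w] at hfw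
    rcases eq_or_ne w 0 with rfl | hw0
    · exact zero_mul _
    · exact mul_left_cancel₀ hw0 (by linear_combination hfw - w * g w * hq.mul_deriv w hw)
  have hu : ∀ w ∈ disk, HasDerivAt (fun z => g z * Complex.exp (-q z))
      (deriv g w * Complex.exp (-q w) + g w * (Complex.exp (-q w) * -deriv q w)) w := fun w hw =>
    (hasDerivAt_of_mem_disk hg hw).fun_mul
      (hasDerivAt_of_mem_disk hq.differentiableOn hw).fun_neg.cexp
  have hconst := eq_apply_zero_of_mul_deriv_eq_zero
    (fun w hw => (hu w hw).differentiableAt.differentiableWithinAt)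
    (fun w hw => by rw [(hu w hw).deriv]; linear_combination Complex.exp (-q w) * hode w hw) hz
  have hg0 : g 0 = 1 := (dslope_same f 0).trans hf1
  rw [hq.map_zero, neg_zero, Complex.exp_zero, hg0, mul_one, Complex.exp_neg,
    ← div_eq_mul_inv, div_eq_one_iff_eq (Complex.exp_ne_zero _)] at hconst
  rw [congrFun hfg z, hconst]

lemma IsClassS.mul_deriv_eq {f p : ℂ → ℂ} (hf : IsClassS f)
    (hp : ∀ z ∈ disk, logDerivQuotient f z = p z) {z : ℂ} (hz : z ∈ disk) :
    z * deriv f z = p z * f z := by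
  rcases eq_or_ne z 0 with rfl | h0
  · rw [hf.map_zero, zero_mul, mul_zero]
  · have hfz : f z ≠ 0 := fun h => h0 (hf.univalent hz zero_mem_disk (h.trans hf.map_zero.symm))
    rw [← hp z hz, logDerivQuotient, if_neg h0, div_mul_cancel₀ _ hfz]

/-- The Noshiro–Warschawski theorem. -/
lemma injOn_of_re_deriv_pos {F F' : ℂ → ℂ} {s : Set ℂ} (hs : Convex ℝ s)
    (hF : ∀ z ∈ s, HasDerivAt F (F' z) z) (hre : ∀ z ∈ s, 0 < (F' z).re) : Set.InjOn F s := by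
  intro a ha b hb hab
  by_contra hne
  have hmem : ∀ t ∈ Set.Icc (0 : ℝ) 1, a + t * (b - a) ∈ s := fun t ht => by
    simpa using hs.add_smul_sub_mem ha hb ht
  have hderiv : ∀ t ∈ Set.Icc (0 : ℝ) 1, HasDerivAt
      (fun t : ℝ => (F (a + t * (b - a)) / (b - a)).re) (F' (a + t * (b - a))).re t := by
    intro t ht
    have hline : HasDerivAt (fun t : ℂ => a + t * (b - a)) (b - a) t := by
      simpa using ((hasDerivAt_id' (t : ℂ)).mul_const (b - a)).const_add a
    have := ((HasDerivAt.comp (t : ℂ) (hF _ (hmem t ht)) hline).div_const (b - a)).real_of_complex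
    rwa [mul_div_cancel_right₀ _ (sub_ne_zero.2 (Ne.symm hne))] at this
  obtain ⟨t, ht, ht0⟩ := exists_hasDerivAt_eq_zero zero_lt_one
    (fun t ht => (hderiv t ht).continuousAt.continuousWithinAt) (by simp [hab])
    fun t ht => hderiv t (Set.Ioo_subset_Icc_self ht)
  exact (hre _ (hmem t (Set.Ioo_subset_Icc_self ht))).ne' ht0

lemma exp_mem_disk {s : ℂ} (hs : s.re < 0) : Complex.exp s ∈ disk := by
  rw [mem_disk, Complex.norm_exp]
  exact Real.exp_lt_one_iff.2 hs

lemma re_log_neg {z : ℂ} (hz : z ∈ disk) (h0 : z ≠ 0) : (Complex.log z).re < 0 := by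
  rw [Complex.log_re]
  exact Real.log_neg (norm_pos_iff.2 h0) (mem_disk.1 hz)

lemma IsExponent.injOn_add_comp_exp {p q : ℂ → ℂ} (hq : IsExponent p q)
    (hre : ∀ z ∈ disk, 0 < (p z).re) :
    Set.InjOn (fun s => s + q (Complex.exp s)) {s | s.re < 0} := by
  refine injOn_of_re_deriv_pos (convex_halfSpace_re_lt 0) (F' := fun s => p (Complex.exp s))
    (fun s hs => ?_) fun s hs => hre _ (exp_mem_disk hs)
  refine ((hasDerivAt_id' s).fun_add ((hasDerivAt_of_mem_disk hq.differentiableOn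
    (exp_mem_disk hs)).comp s (Complex.hasDerivAt_exp s))).congr_deriv ?_
  linear_combination hq.mul_deriv _ (exp_mem_disk hs)

lemma IsExponent.injOn_mul_exp {p q : ℂ → ℂ} (hq : IsExponent p q)
    (hre : ∀ z ∈ disk, 0 < (p z).re) :
    Set.InjOn (fun z => z * Complex.exp (q z)) disk := by
  -- In the coordinate `s = log z` the map becomes `s + q (exp s)`, up to periods of `exp`.
  have hzero : ∀ {z : ℂ}, z * Complex.exp (q z) = 0 ↔ z = 0 := by simp
  intro z hz w hw (hzw : z * Complex.exp (q z) = w * Complex.exp (q w))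
  rcases eq_or_ne w 0 with rfl | hw0
  · exact hzero.1 (by rw [hzw, zero_mul])
  have hz0 : z ≠ 0 := fun h => hw0 (hzero.1 (by rw [← hzw, h, zero_mul]))
  have hexp : Complex.exp (Complex.log z + q z) = Complex.exp (Complex.log w + q w) := by
    rw [Complex.exp_add, Complex.exp_add, Complex.exp_log hz0, Complex.exp_log hw0, hzw]
  obtain ⟨n, hn⟩ := Complex.exp_eq_exp_iff_exists_int.1 hexp
  set s := Complex.log w + n * (2 * Real.pi * Complex.I) with hs
  have hsw : Complex.exp s = w := by
    rw [hs, Complex.exp_add, Complex.exp_int_mul_two_pi_mul_I, mul_one, Complex.exp_log hw0]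
  have hsre : s.re < 0 := by simpa [hs] using re_log_neg hw hw0
  have hlog : Complex.log z = s := by
    refine hq.injOn_add_comp_exp hre (re_log_neg hz hz0) hsre ?_
    simp only [Complex.exp_log hz0, hsw]
    rw [hn, hs]
    ring
  rw [← Complex.exp_log hz0, hlog, hsw]

lemma IsExponent.isExtremal {p q : ℂ → ℂ} (hq : IsExponent p q) (hre : ∀ z ∈ disk, 0 < (p z).re) :
    IsExtremal p fun z => z * Complex.exp (q z) := by
  refine ⟨⟨differentiableOn_id.mul hq.differentiableOn.cexp, zero_mul _, ?_,
    hq.injOn_mul_exp hre⟩, fun z hz => ?_⟩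
  · rw [(hq.hasDerivAt_mul_exp zero_mem_disk).deriv, hq.apply_zero, hq.map_zero, Complex.exp_zero,
      one_mul]
  · rw [logDerivQuotient]
    split_ifs with h0
    · rw [h0, hq.apply_zero]
    · rw [(hq.hasDerivAt_mul_exp hz).deriv, mul_left_comm,
        mul_div_cancel_right₀ _ (mul_ne_zero h0 (Complex.exp_ne_zero _))]

lemma IsExponent.eqOn_of_isExtremal {h p q : ℂ → ℂ} (hq : IsExponent p q) (hh : IsExtremal p h) :
    Set.EqOn h (fun z => z * Complex.exp (q z)) disk := fun _ hz =>
  hq.eq_mul_exp hh.1.analytic hh.1.map_zero hh.1.deriv_zero (fun _ => hh.1.mul_deriv_eq hh.2) hz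

lemma exists_isExponent_of_mem_starlikeClass {f φ : ℂ → ℂ} (hφ : DifferentiableOn ℂ φ disk)
    (h1 : φ 0 = 1) (hf : f ∈ StarlikeClass φ) :
    ∃ ω q, IsSchwarz ω ∧ IsExponent (fun z => φ (ω z)) q ∧
      Set.EqOn f (fun z => z * Complex.exp (q z)) disk := by
  obtain ⟨hS, ω, hω, hmaps, hω0, hfω⟩ := hf
  obtain ⟨q, hq⟩ := exists_isExponent (hφ.comp hω hmaps) (by simp [hω0, h1])
  exact ⟨ω, q, ⟨hω, hmaps, hω0⟩, hq, hq.eqOn_of_isExtremal ⟨hS, hfω⟩⟩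

/-! ### The lower growth bound -/

section

variable {q : ℂ → ℂ} {g g' : ℝ → ℝ}

lemma im_mul_deriv_eq_zero_of_isMinOn_sphere {q' w : ℂ} (hq : HasDerivAt q q' w)
    (hmin : IsMinOn (fun z => (q z).re) (Metric.sphere 0 ‖w‖) w) : (w * q').im = 0 := by
  set γ : ℝ → ℂ := fun t => w * Complex.exp (t * Complex.I)
  have hγ0 : γ 0 = w := by simp [γ]
  have hγ : HasDerivAt γ (w * Complex.I) 0 := by
    simpa using ((Complex.ofRealCLM.hasDerivAt (x := 0)).mul_const Complex.I).cexp.const_mul w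
  have hqγ : HasDerivAt (fun t => (q (γ t)).re) (q' * (w * Complex.I)).re 0 :=
    Complex.reCLM.hasFDerivAt.comp_hasDerivAt 0 (HasDerivAt.comp 0 (by rwa [hγ0]) hγ)
  have hloc : IsLocalMin (fun t => (q (γ t)).re) 0 := Eventually.of_forall fun t => by
    simp only [hγ0]
    exact hmin (by simp [γ, Complex.norm_exp_ofReal_mul_I])
  have hzero := hloc.hasDerivAt_eq_zero hqγ
  rw [← mul_assoc, Complex.mul_I_re, neg_eq_zero] at hzero
  rw [mul_comm, hzero]

lemma deriv_nonpos_of_isMinOn_right_endpoint {v : ℝ → ℝ} {v' a b : ℝ} (hab : a < b)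
    (hv : HasDerivAt v v' b) (hmin : IsMinOn v (Set.Icc a b) b) : v' ≤ 0 := by
  refine le_of_tendsto ((hasDerivAt_iff_tendsto_slope.1 hv).mono_left (nhdsLT_le_nhdsNE b)) ?_
  filter_upwards [Ioo_mem_nhdsLT hab] with s hs
  rw [slope_def_field]
  exact div_nonpos_of_nonneg_of_nonpos (sub_nonneg.2 (hmin (Set.Ioo_subset_Icc_self hs)))
    (sub_nonpos.2 hs.2.le)

lemma re_mul_deriv_le_of_isMinOn_closedBall {q' w : ℂ} {d : ℝ} (hq : HasDerivAt q q' w)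
    (hg : HasDerivAt g d ‖w‖)
    (hmin : IsMinOn (fun z => (q z).re - g ‖z‖) (Metric.closedBall 0 ‖w‖) w) :
    (w * q').re ≤ ‖w‖ * d := by
  set v : ℝ → ℝ := fun s => (q (s * w)).re - g (s * ‖w‖)
  have hq1 : HasDerivAt (fun s : ℝ => (q (s * w)).re) (q' * w).re 1 := by
    have hline : HasDerivAt (fun s : ℂ => s * w) w (1 : ℝ) := by
      simpa using (hasDerivAt_id' ((1 : ℝ) : ℂ)).mul_const w
    exact (HasDerivAt.comp ((1 : ℝ) : ℂ) (by simpa using hq) hline).real_of_complex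
  have hg1 : HasDerivAt (fun s : ℝ => g (s * ‖w‖)) (d * ‖w‖) 1 := by
    have hline : HasDerivAt (fun s : ℝ => s * ‖w‖) ‖w‖ 1 := by
      simpa using (hasDerivAt_id' (1 : ℝ)).mul_const ‖w‖
    exact HasDerivAt.comp 1 (by simpa using hg) hline
  have hv : IsMinOn v (Set.Icc 0 1) 1 := by
    intro s hs
    have hnorm : ‖(s : ℂ) * w‖ = s * ‖w‖ := by
      rw [norm_mul, Complex.norm_real, Real.norm_of_nonneg hs.1]
    have hle : (q w).re - g ‖w‖ ≤ (q (s * w)).re - g ‖(s : ℂ) * w‖ := hmin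
      (mem_closedBall_zero_iff.2 (hnorm.trans_le (mul_le_of_le_one_left (norm_nonneg w) hs.2)))
    rw [hnorm] at hle
    simpa [v] using hle
  have := deriv_nonpos_of_isMinOn_right_endpoint zero_lt_one (hq1.fun_sub hg1) hv
  rw [mul_comm w, mul_comm ‖w‖]
  exact sub_nonpos.1 this

lemma le_re_of_lt_re_mul_deriv (hq : DifferentiableOn ℂ q disk)
    (hg : ∀ ρ ∈ Set.Ico 0 1, HasDerivAt g (g' ρ) ρ) (h0 : g 0 ≤ (q 0).re)
    (hlt : ∀ w ∈ disk, w ≠ 0 → (w * deriv q w).im = 0 → ‖w‖ * g' ‖w‖ < (w * deriv q w).re)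
    {z : ℂ} (hz : z ∈ disk) : g ‖z‖ ≤ (q z).re := by
  -- At a minimum `w ≠ 0` of `Re q z - g ‖z‖`, `w q'(w)` is real and at most `‖w‖ g'(‖w‖)`.
  have hsub := closedBall_subset_disk (mem_disk.1 hz)
  have hnorm : ∀ w ∈ disk, ‖w‖ ∈ Set.Ico 0 1 := fun w hw => ⟨norm_nonneg w, mem_disk.1 hw⟩
  have hcont : ContinuousOn (fun w => (q w).re - g ‖w‖) (Metric.closedBall 0 ‖z‖) :=
    (Complex.continuous_re.comp_continuousOn (hq.continuousOn.mono hsub)).sub fun w hw =>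
      ((hg _ (hnorm w (hsub hw))).continuousAt.comp continuous_norm.continuousAt).continuousWithinAt
  obtain ⟨w, hw, hmin⟩ := (isCompact_closedBall (0 : ℂ) ‖z‖).exists_isMinOn ⟨0, by simp⟩ hcont
  have hwz := mem_closedBall_zero_iff.1 hw
  have hwd := hasDerivAt_of_mem_disk hq (hsub hw)
  rcases eq_or_ne w 0 with rfl | hw0
  · have := hmin (mem_closedBall_zero_iff.2 le_rfl : z ∈ Metric.closedBall 0 ‖z‖)
    simp only [Set.mem_ofPred_eq, norm_zero] at this
    linarith
  have him : (w * deriv q w).im = 0 := by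
    refine im_mul_deriv_eq_zero_of_isMinOn_sphere hwd fun ζ hζ => ?_
    have hζ := mem_sphere_zero_iff_norm.1 hζ
    simpa [hζ] using hmin (mem_closedBall_zero_iff.2 (hζ.trans_le hwz))
  have hre := re_mul_deriv_le_of_isMinOn_closedBall hwd (hg _ (hnorm w (hsub hw)))
    (hmin.on_subset (Metric.closedBall_subset_closedBall hwz))
  exact absurd hre (hlt w (hsub hw) hw0 him).not_ge

lemma le_re_of_le_re_mul_deriv (hq : DifferentiableOn ℂ q disk)
    (hg : ∀ ρ ∈ Set.Ico 0 1, HasDerivAt g (g' ρ) ρ) (h0 : g 0 ≤ (q 0).re)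
    (hle : ∀ w ∈ disk, (w * deriv q w).im = 0 → ‖w‖ * g' ‖w‖ ≤ (w * deriv q w).re)
    {z : ℂ} (hz : z ∈ disk) : g ‖z‖ ≤ (q z).re := by
  refine le_of_forall_pos_le_add fun ε hε => ?_
  have hz1 := mem_disk.1 hz
  have := le_re_of_lt_re_mul_deriv (g := fun ρ => g ρ - ε * ρ) (g' := fun ρ => g' ρ - ε) hq
    (fun ρ hρ => by simpa using (hg ρ hρ).fun_sub ((hasDerivAt_id' ρ).const_mul ε))
    (by simpa using h0) (fun w hw hw0 him => ?_) hz
  · nlinarith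
  · have := hle w hw him
    have := mul_pos (norm_pos_iff.2 hw0) hε
    rw [mul_sub]
    linarith

end

section

variable {f : ℂ → ℂ} {x : ℝ}

lemma conj_mem_disk {z : ℂ} (hz : z ∈ disk) : conj z ∈ disk := by
  rwa [mem_disk, RCLike.norm_conj, ← mem_disk]

lemma map_conj_of_im_taylorCoeff_eq_zero (hf : DifferentiableOn ℂ f disk)
    (him : ∀ n, (taylorCoeff f n).im = 0) {z : ℂ} (hz : z ∈ disk) : f (conj z) = conj (f z) := by
  refine (hasSum_taylorCoeff hf (conj_mem_disk hz)).unique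
    (((hasSum_taylorCoeff hf hz).mapL (Complex.conjCLE : ℂ →L[ℝ] ℂ)).congr_fun fun n => ?_)
  simp [Complex.conj_eq_iff_im.2 (him n)]

lemma im_apply_ofReal_eq_zero (hf : DifferentiableOn ℂ f disk)
    (him : ∀ n, (taylorCoeff f n).im = 0) (hx : x ∈ Set.Ioo (-1 : ℝ) 1) : (f x).im = 0 := by
  rw [← Complex.conj_eq_iff_im, ← map_conj_of_im_taylorCoeff_eq_zero hf him (ofReal_mem_disk hx),
    Complex.conj_ofReal]

lemma eq_ofReal_re_of_im_apply_eq_zero (hf : DifferentiableOn ℂ f disk) (hinj : Set.InjOn f disk)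
    (him : ∀ n, (taylorCoeff f n).im = 0) {w : ℂ} (hw : w ∈ disk) (hfw : (f w).im = 0) :
    w = w.re := by
  have hconj := map_conj_of_im_taylorCoeff_eq_zero hf him hw
  rw [Complex.conj_eq_iff_im.2 hfw] at hconj
  exact (Complex.conj_eq_iff_re.1 (hinj (conj_mem_disk hw) hw hconj)).symm

lemma continuousOn_re_ofReal (hf : DifferentiableOn ℂ f disk) :
    ContinuousOn (fun x : ℝ => (f x).re) (Set.Ioo (-1) 1) :=
  Complex.continuous_re.comp_continuousOn
    (hf.continuousOn.comp Complex.continuous_ofReal.continuousOn fun _ hx => ofReal_mem_disk hx)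

lemma hasDerivAt_re_ofReal (hf : DifferentiableOn ℂ f disk) (hx : x ∈ Set.Ioo (-1 : ℝ) 1) :
    HasDerivAt (fun x : ℝ => (f x).re) (deriv f x).re x :=
  (hasDerivAt_of_mem_disk hf (ofReal_mem_disk hx)).real_of_complex

lemma hasSum_norm_taylorCoeff_mul_pow (hf : DifferentiableOn ℂ f disk)
    (hnn : ∀ n, 0 ≤ taylorCoeff f n) (hx : x ∈ Set.Ioo (-1 : ℝ) 1) :
    HasSum (fun n => ‖taylorCoeff f n‖ * x ^ n) (f x).re := by
  refine (Complex.hasSum_re (hasSum_taylorCoeff hf (ofReal_mem_disk hx))).congr_fun fun n => ?_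
  rw [← Complex.ofReal_pow, Complex.re_mul_ofReal, Complex.re_eq_norm.2 (hnn n)]

lemma majorantSum_le_re_apply (hf : DifferentiableOn ℂ f disk) (hnn : ∀ n, 0 ≤ taylorCoeff f n)
    {r : ℝ} (hr0 : 0 ≤ r) (hr1 : r < 1) (N : ℕ) : majorantSum f r N ≤ (f r).re :=
  sum_le_hasSum _ (fun n _ => by positivity)
    (hasSum_norm_taylorCoeff_mul_pow hf hnn ⟨by linarith, hr1⟩)

lemma im_taylorCoeff_eq_zero (hnn : ∀ n, 0 ≤ taylorCoeff f n) (n : ℕ) :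
    (taylorCoeff f n).im = 0 :=
  (Complex.nonneg_iff.1 (hnn n)).2.symm

lemma strictMonoOn_re_ofReal (hf : DifferentiableOn ℂ f disk) (hinj : Set.InjOn f disk)
    (hnn : ∀ n, 0 ≤ taylorCoeff f n) :
    StrictMonoOn (fun x : ℝ => (f x).re) (Set.Ioo (-1) 1) := by
  have him {x : ℝ} (hx : x ∈ Set.Ioo (-1 : ℝ) 1) : (f x).im = 0 :=
    im_apply_ofReal_eq_zero hf (im_taylorCoeff_eq_zero hnn) hx
  have hinjre : Set.InjOn (fun x : ℝ => (f x).re) (Set.Ioo (-1) 1) := fun x hx y hy hxy =>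
    Complex.ofReal_injective (hinj (ofReal_mem_disk hx) (ofReal_mem_disk hy)
      (Complex.ext hxy ((him hx).trans (him hy).symm)))
  refine (ContinuousOn.strictMonoOn_of_injOn_Ioo (by norm_num)
    (continuousOn_re_ofReal hf) hinjre).resolve_right fun hanti => ?_
  have hlt : (f (1 / 2 : ℝ)).re < (f (0 : ℝ)).re :=
    hanti (by norm_num) (by norm_num) (by norm_num)
  have hle := majorantSum_le_re_apply hf hnn (r := 1 / 2) (by norm_num) (by norm_num) 1
  simp only [majorantSum, Finset.sum_range_one, taylorCoeff_zero, pow_zero, mul_one] at hle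
  rw [Complex.ofReal_zero] at hlt
  exact (hlt.trans_le ((Complex.re_le_norm (f 0)).trans hle)).false

lemma IsExponent.re_neg_norm_le {φ Q q ω : ℂ → ℂ} (hφ : DifferentiableOn ℂ φ disk)
    (hinj : Set.InjOn φ disk) (hnn : ∀ n, 0 ≤ taylorCoeff φ n) (hQ : IsExponent φ Q)
    (hω : IsSchwarz ω) (hq : IsExponent (fun z => φ (ω z)) q) {z : ℂ} (hz : z ∈ disk) :
    (Q (-‖z‖ : ℝ)).re ≤ (q z).re := by
  refine le_re_of_le_re_mul_deriv (g := fun ρ => (Q (-ρ : ℝ)).re)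
    (g' := fun ρ => -(deriv Q (-ρ : ℝ)).re) hq.differentiableOn (fun ρ hρ => ?_)
    (by simp [hQ.map_zero, hq.map_zero]) (fun w hw him => ?_) hz
  · have hderiv : HasDerivAt (fun x : ℝ => (Q x).re) (deriv Q (-ρ : ℝ)).re (-ρ) :=
      hasDerivAt_re_ofReal hQ.differentiableOn ⟨by linarith [hρ.2], by linarith [hρ.1]⟩
    simpa [Function.comp_def] using HasDerivAt.comp ρ hderiv (hasDerivAt_neg' ρ)
  have hQw := hQ.mul_re_deriv_ofReal (neg_norm_mem_Ioo hw)
  rw [hq.mul_deriv w hw, Complex.sub_im, Complex.one_im, sub_zero] at him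
  have hreal := eq_ofReal_re_of_im_apply_eq_zero hφ hinj (im_taylorCoeff_eq_zero hnn)
    (hω.mapsTo hw) him
  have habs : |(ω w).re| ≤ ‖w‖ := (Complex.abs_re_le_norm _).trans (hω.norm_le hw)
  calc ‖w‖ * -(deriv Q (-‖w‖ : ℝ)).re = (φ (-‖w‖ : ℝ)).re - 1 := by rw [← hQw]; ring
    _ ≤ (φ (ω w).re).re - 1 :=
        sub_le_sub_right ((strictMonoOn_re_ofReal hφ hinj hnn).monotoneOn (neg_norm_mem_Ioo hw)
          (abs_lt.1 (habs.trans_lt (mem_disk.1 hw))) (neg_le_of_abs_le habs)) 1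
    _ = (w * deriv q w).re := by
        rw [hq.mul_deriv w hw, ← hreal, Complex.sub_re, Complex.one_re]

end

/-! ### The boundary of a univalent image -/

section

variable {f : ℂ → ℂ} {s : Set ℂ}

lemma isOpen_image_of_deriv_ne_zero (hs : IsOpen s) (hf : DifferentiableOn ℂ f s)
    (hd : ∀ z ∈ s, deriv f z ≠ 0) : IsOpen (f '' s) := by
  rw [isOpen_iff_mem_nhds]
  rintro _ ⟨z, hz, rfl⟩
  have hfz : HasStrictDerivAt f (deriv f z) z :=
    (hf.analyticAt (hs.mem_nhds hz)).hasStrictDerivAt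
  rw [← hfz.map_nhds_eq (hd z hz)]
  exact image_mem_map (hs.mem_nhds hz)

lemma image_ne_univ_of_injOn (hs : IsOpen s) (hb : Bornology.IsBounded s)
    (hf : DifferentiableOn ℂ f s) (hinj : Set.InjOn f s) (hd : ∀ z ∈ s, deriv f z ≠ 0) :
    f '' s ≠ Set.univ := by
  -- Otherwise the inverse of `f` is a bounded entire function, hence constant.
  intro huniv
  set g := Function.invFunOn f s
  have hmem : ∀ y, y ∈ f '' s := fun y => huniv ▸ Set.mem_univ y
  have hg : Differentiable ℂ g := by
    intro y
    obtain ⟨z, hz, rfl⟩ := hmem y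
    have hfz : HasStrictDerivAt f (deriv f z) z :=
      (hf.analyticAt (hs.mem_nhds hz)).hasStrictDerivAt
    have hleft : ∀ᶠ x in 𝓝 z, g (f x) = x := by
      filter_upwards [hs.mem_nhds hz] with x hx using hinj.leftInvOn_invFunOn hx
    exact (hfz.to_local_left_inverse (hd z hz) hleft).hasDerivAt.differentiableAt
  have hgb : Bornology.IsBounded (Set.range g) :=
    hb.subset (Set.range_subset_iff.2 fun y => Function.invFunOn_mem (hmem y))
  have hconst := congrArg f (hg.apply_eq_apply_of_bounded hgb 0 1)
  rw [Function.invFunOn_eq (hmem 0), Function.invFunOn_eq (hmem 1)] at hconst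
  exact zero_ne_one hconst

lemma le_boundaryDist (hf : DifferentiableOn ℂ f disk) (hinj : Set.InjOn f disk)
    (hd : ∀ z ∈ disk, deriv f z ≠ 0) {m : ℝ → ℝ} {L : ℝ} (hm : Tendsto m (𝓝[<] 1) (𝓝 L))
    (hle : ∀ z ∈ disk, m ‖z‖ ≤ dist (f 0) (f z)) : L ≤ boundaryDist f := by
  have hne : (frontier (f '' disk)).Nonempty := nonempty_frontier_iff.2
    ⟨⟨f 0, 0, zero_mem_disk, rfl⟩,
      image_ne_univ_of_injOn isOpen_disk Metric.isBounded_ball hf hinj hd⟩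
  rw [boundaryDist, Metric.le_infDist hne]
  intro w hw
  by_contra! hlt
  obtain ⟨t, hwt, htL⟩ := exists_between hlt
  obtain ⟨ρ, hρ1 : ρ < 1, hρ⟩ := mem_nhdsLT_iff_exists_Ioo_subset.1 (hm.eventually_const_lt htL)
  have hsub := closedBall_subset_disk hρ1
  have hclosed : IsClosed (f '' Metric.closedBall 0 ρ ∪ {y | t ≤ dist (f 0) y}) :=
    ((isCompact_closedBall _ _).image_of_continuousOn (hf.continuousOn.mono hsub)).isClosed.union
      (isClosed_le continuous_const (continuous_const.dist continuous_id))
  have hcover : f '' disk ⊆ f '' Metric.closedBall 0 ρ ∪ {y | t ≤ dist (f 0) y} := by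
    rintro _ ⟨z, hz, rfl⟩
    rcases le_or_gt ‖z‖ ρ with hzρ | hρz
    · exact Or.inl ⟨z, mem_closedBall_zero_iff.2 hzρ, rfl⟩
    · have htm : t < m ‖z‖ := hρ ⟨hρz, mem_disk.1 hz⟩
      exact Or.inr (htm.le.trans (hle z hz))
  rcases closure_minimal hcover hclosed hw.1 with hwρ | hwt'
  · exact hw.2 (by
      rw [(isOpen_image_of_deriv_ne_zero isOpen_disk hf hd).interior_eq]
      exact Set.image_mono hsub hwρ)
  · exact hwt.not_ge hwt'

lemma notMem_image_of_tendsto (hf : DifferentiableOn ℂ f disk) (hinj : Set.InjOn f disk)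
    (hd : ∀ z ∈ disk, deriv f z ≠ 0) {ι : Type*} {l : Filter ι} [l.NeBot] {u : ι → ℂ} {w : ℂ}
    (hu : Tendsto (fun i => ‖u i‖) l (𝓝[<] 1)) (hw : Tendsto (fun i => f (u i)) l (𝓝 w)) :
    w ∉ f '' disk := by
  rintro ⟨z, hz, rfl⟩
  obtain ⟨ρ, hzρ, hρ1⟩ := exists_between (mem_disk.1 hz)
  have hsub : Metric.ball (0 : ℂ) ρ ⊆ disk := Metric.ball_subset_ball hρ1.le
  have hnhds : f '' Metric.ball 0 ρ ∈ 𝓝 (f z) :=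
    (isOpen_image_of_deriv_ne_zero Metric.isOpen_ball (hf.mono hsub)
      fun x hx => hd x (hsub hx)).mem_nhds ⟨z, mem_ball_zero_iff.2 hzρ, rfl⟩
  obtain ⟨i, ⟨x, hx, hxi⟩, hρi, hi1⟩ :=
    ((hw.eventually hnhds).and (hu.eventually (Ioo_mem_nhdsLT hρ1))).exists
  rw [hinj (hsub hx) (mem_disk.2 hi1) hxi, mem_ball_zero_iff] at hx
  exact lt_asymm hx hρi

lemma boundaryDist_le_of_tendsto (hf : DifferentiableOn ℂ f disk) (hinj : Set.InjOn f disk)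
    (hd : ∀ z ∈ disk, deriv f z ≠ 0) {ι : Type*} {l : Filter ι} [l.NeBot] {u : ι → ℂ} {w : ℂ}
    (hu : Tendsto (fun i => ‖u i‖) l (𝓝[<] 1)) (hw : Tendsto (fun i => f (u i)) l (𝓝 w)) :
    boundaryDist f ≤ dist (f 0) w := by
  refine Metric.infDist_le_dist_of_mem ⟨mem_closure_of_tendsto hw ?_, fun h =>
    notMem_image_of_tendsto hf hinj hd hu hw (interior_subset h)⟩
  filter_upwards [hu.eventually self_mem_nhdsWithin] with i hi using ⟨_, mem_disk.2 hi, rfl⟩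

end

/-! ### The Bohr estimate -/

section

variable {f p q φ Q ω : ℂ → ℂ} {r : ℝ}

lemma IsExponent.eqOn (hq : IsExponent p q) :
    Set.EqOn p (fun z => 1 + z * deriv q z) disk := fun z hz =>
  (add_eq_of_eq_sub' (hq.mul_deriv z hz)).symm

lemma IsExponent.taylorCoeff_deriv (hq : IsExponent p q) (n : ℕ) :
    taylorCoeff (deriv q) n = taylorCoeff p (n + 1) := by
  rw [taylorCoeff_congr_of_eqOn hq.eqOn, taylorCoeff_const_add_succ, taylorCoeff_id_mul]
  exact (analyticAt_of_mem_disk hq.differentiableOn zero_mem_disk).deriv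

lemma IsExponent.majorantSum_eq (hq : IsExponent p q) (r : ℝ) (N : ℕ) :
    majorantSum p r (N + 1) = 1 + r * majorantSum (deriv q) r N := by
  rw [majorantSum_congr hq.eqOn, majorantSum_const_add_id_mul _ _, norm_one]
  exact (analyticAt_of_mem_disk hq.differentiableOn zero_mem_disk).deriv

lemma deriv_exp_eqOn (hq : DifferentiableOn ℂ q disk) :
    Set.EqOn (deriv fun z => Complex.exp (q z)) (fun z => deriv q z * Complex.exp (q z)) disk := by
  intro z hz
  rw [(hasDerivAt_of_mem_disk hq hz).cexp.deriv, mul_comm]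

lemma majorantSum_deriv_exp_le (hq : DifferentiableOn ℂ q disk) (hr : 0 ≤ r) (N : ℕ) :
    majorantSum (deriv fun z => Complex.exp (q z)) r N ≤
      majorantSum (deriv q) r N * majorantSum (fun z => Complex.exp (q z)) r (N + 1) := by
  have hq0 := analyticAt_of_mem_disk hq zero_mem_disk
  calc majorantSum (deriv fun z => Complex.exp (q z)) r N
      = majorantSum (fun z => deriv q z * Complex.exp (q z)) r N :=
        majorantSum_congr (deriv_exp_eqOn hq) r N
    _ ≤ majorantSum (deriv q) r N * majorantSum (fun z => Complex.exp (q z)) r N :=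
        majorantSum_mul_le hq0.deriv hq0.cexp hr N
    _ ≤ majorantSum (deriv q) r N * majorantSum (fun z => Complex.exp (q z)) r (N + 1) :=
        mul_le_mul_of_nonneg_left (majorantSum_mono _ hr N.le_succ) (majorantSum_nonneg _ hr N)

lemma IsExponent.majorantSum_deriv_le (hφ : DifferentiableOn ℂ φ disk)
    (hnn : ∀ n, 0 ≤ taylorCoeff φ n) (hQ : IsExponent φ Q) (hω : IsSchwarz ω)
    (hq : IsExponent (fun z => φ (ω z)) q) (hr0 : 0 < r) (hr3 : r ≤ 1 / 3) (N : ℕ) :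
    majorantSum (deriv q) r N ≤ (deriv Q r).re := by
  refine le_of_mul_le_mul_left (le_of_add_le_add_left (a := 1) ?_) hr0
  calc 1 + r * majorantSum (deriv q) r N = majorantSum (fun z => φ (ω z)) r (N + 1) :=
        (hq.majorantSum_eq r N).symm
    _ ≤ majorantSum φ r (N + 1) := majorantSum_comp_le hω hφ hr0.le hr3 (N + 1)
    _ ≤ (φ r).re := majorantSum_le_re_apply hφ hnn hr0.le (by linarith) (N + 1)
    _ = 1 + r * (deriv Q r).re := by
        rw [hQ.mul_re_deriv_ofReal ⟨by linarith, by linarith⟩, add_sub_cancel]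

lemma antitoneOn_mul_exp_neg {F F' G G' : ℝ → ℝ} {a b : ℝ}
    (hF : ∀ x ∈ Set.Icc a b, HasDerivAt F (F' x) x) (hG : ∀ x ∈ Set.Icc a b, HasDerivAt G (G' x) x)
    (hle : ∀ x ∈ Set.Ioo a b, F' x ≤ G' x * F x) :
    AntitoneOn (fun x => F x * Real.exp (-G x)) (Set.Icc a b) := by
  have hderiv : ∀ x ∈ Set.Icc a b, HasDerivAt (fun x => F x * Real.exp (-G x))
      ((F' x - G' x * F x) * Real.exp (-G x)) x := fun x hx =>
    ((hF x hx).fun_mul (hG x hx).fun_neg.exp).congr_deriv (by ring)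
  refine antitoneOn_of_hasDerivWithinAt_nonpos (convex_Icc a b)
    (fun x hx => (hderiv x hx).continuousAt.continuousWithinAt)
    (fun x hx => (hderiv x (interior_subset hx)).hasDerivWithinAt) fun x hx => ?_
  rw [interior_Icc] at hx
  exact mul_nonpos_of_nonpos_of_nonneg (sub_nonpos.2 (hle x hx)) (Real.exp_pos _).le

lemma IsExponent.majorantSum_exp_le (hφ : DifferentiableOn ℂ φ disk)
    (hnn : ∀ n, 0 ≤ taylorCoeff φ n) (hQ : IsExponent φ Q) (hω : IsSchwarz ω)
    (hq : IsExponent (fun z => φ (ω z)) q) (hr0 : 0 ≤ r) (hr3 : r ≤ 1 / 3) (N : ℕ) :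
    majorantSum (fun z => Complex.exp (q z)) r (N + 1) ≤ Real.exp (Q r).re := by
  have hanti := antitoneOn_mul_exp_neg (a := 0) (b := 1 / 3)
    (fun x _ => hasDerivAt_majorantSum (fun z => Complex.exp (q z)) x N)
    (fun x hx => hasDerivAt_re_ofReal hQ.differentiableOn
      ⟨by linarith [hx.1], by linarith [hx.2]⟩)
    fun x hx => (majorantSum_deriv_exp_le hq.differentiableOn hx.1.le N).trans
      (mul_le_mul_of_nonneg_right (hQ.majorantSum_deriv_le hφ hnn hω hq hx.1 hx.2.le N)
        (majorantSum_nonneg _ hx.1.le _))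
  have hle := hanti (by norm_num) ⟨hr0, hr3⟩ hr0
  have hstart : majorantSum (fun z => Complex.exp (q z)) 0 (N + 1) = 1 := by
    simp [majorantSum, Finset.sum_range_succ', taylorCoeff_zero, hq.map_zero]
  simp only [hstart, Complex.ofReal_zero, hQ.map_zero, Complex.zero_re, neg_zero, Real.exp_zero,
    mul_one, Real.exp_neg] at hle
  rwa [← div_eq_mul_inv, div_le_one (Real.exp_pos _)] at hle

lemma IsClassS.majorantSum_add_two (hf : IsClassS f) (r : ℝ) (N : ℕ) :
    majorantSum f r (N + 2) = r + ∑ n ∈ Finset.range N, majorantTerm f r n := by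
  have h1 : taylorCoeff f 1 = 1 := by simp [taylorCoeff, hf.deriv_zero]
  simp only [majorantSum, majorantTerm, Finset.sum_range_succ', taylorCoeff_zero, hf.map_zero, h1,
    norm_zero, norm_one, zero_mul, zero_add, pow_one, one_mul, add_zero]
  ring

lemma majorantSum_of_eqOn_mul_exp (hq : DifferentiableOn ℂ q disk)
    (hfq : Set.EqOn f (fun z => z * Complex.exp (q z)) disk) (r : ℝ) (N : ℕ) :
    majorantSum f r (N + 1) = r * majorantSum (fun z => Complex.exp (q z)) r N := by
  have hf : Set.EqOn f (fun z => 0 + z * Complex.exp (q z)) disk := by simpa only [zero_add]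
  rw [majorantSum_congr hf, majorantSum_const_add_id_mul, norm_zero, zero_add]
  exact (analyticAt_of_mem_disk hq zero_mem_disk).cexp

lemma taylorCoeff_deriv_nonneg_iff {n : ℕ} :
    0 ≤ taylorCoeff (deriv f) n ↔ 0 ≤ taylorCoeff f (n + 1) := by
  have hn : (0 : ℂ) < n + 1 := mod_cast n.succ_pos
  rw [taylorCoeff_deriv]
  exact ⟨fun h => le_of_mul_le_mul_left (by simpa only [mul_zero] using h) hn, mul_nonneg hn.le⟩

lemma IsExponent.taylorCoeff_nonneg (hq : IsExponent p q) (hnn : ∀ n, 0 ≤ taylorCoeff p n)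
    (n : ℕ) : 0 ≤ taylorCoeff q n := by
  rcases n with _ | n
  · rw [taylorCoeff_zero, hq.map_zero]
  · rw [← taylorCoeff_deriv_nonneg_iff, hq.taylorCoeff_deriv]
    exact hnn (n + 1)

lemma taylorCoeff_exp_nonneg (hq : DifferentiableOn ℂ q disk) (hq0 : q 0 = 0)
    (hnn : ∀ n, 0 ≤ taylorCoeff q n) (n : ℕ) :
    0 ≤ taylorCoeff (fun z => Complex.exp (q z)) n := by
  have hqa := analyticAt_of_mem_disk hq zero_mem_disk
  induction n using Nat.strong_induction_on with
  | _ n ih =>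
    rcases n with _ | n
    · simp [taylorCoeff_zero, hq0]
    · rw [← taylorCoeff_deriv_nonneg_iff, taylorCoeff_congr_of_eqOn (deriv_exp_eqOn hq),
        taylorCoeff_mul (g := fun z => Complex.exp (q z)) hqa.deriv hqa.cexp]
      exact Finset.sum_nonneg fun i _ =>
        mul_nonneg (taylorCoeff_deriv_nonneg_iff.2 (hnn (i + 1))) (ih _ (by omega))

lemma taylorCoeff_id_mul_exp_nonneg (hq : DifferentiableOn ℂ q disk) (hq0 : q 0 = 0)
    (hnn : ∀ n, 0 ≤ taylorCoeff q n) (n : ℕ) :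
    0 ≤ taylorCoeff (fun z => z * Complex.exp (q z)) n := by
  rcases n with _ | n
  · rw [taylorCoeff_zero, zero_mul]
  · rw [taylorCoeff_id_mul (g := fun z => Complex.exp (q z))
      (analyticAt_of_mem_disk hq zero_mem_disk).cexp]
    exact taylorCoeff_exp_nonneg hq hq0 hnn n

lemma IsClassS.hasSum_majorantTerm (hf : IsClassS f) (hnn : ∀ n, 0 ≤ taylorCoeff f n)
    (hr : r ∈ Set.Ioo (-1 : ℝ) 1) : HasSum (majorantTerm f r) ((f r).re - r) := by
  have hsum := (hasSum_nat_add_iff' 2).2 (hasSum_norm_taylorCoeff_mul_pow hf.analytic hnn hr)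
  rwa [← majorantSum, hf.majorantSum_add_two r 0, Finset.sum_range_zero, add_zero] at hsum

end

/-! ### The extremal function -/

/-- The values of the extremal function `h z = z * exp (Q z)` on the real axis, as real numbers; the
real part discards nothing when `Q` is real there. -/
noncomputable def profile (Q : ℂ → ℂ) (x : ℝ) : ℝ := x * Real.exp (Q x).re

section

variable {f φ Q : ℂ → ℂ} {x L : ℝ}

lemma neg_profile_neg (Q : ℂ → ℂ) (x : ℝ) :
    -profile Q (-x) = x * Real.exp (Q (-x : ℝ)).re := by
  rw [profile, neg_mul, neg_neg]

lemma IsExponent.ofReal_profile (hQ : IsExponent φ Q) (hnn : ∀ n, 0 ≤ taylorCoeff φ n)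
    (hx : x ∈ Set.Ioo (-1 : ℝ) 1) : (profile Q x : ℂ) = x * Complex.exp (Q x) := by
  have him := im_apply_ofReal_eq_zero hQ.differentiableOn
    (im_taylorCoeff_eq_zero (hQ.taylorCoeff_nonneg hnn)) hx
  rw [profile, Complex.ofReal_mul, Complex.ofReal_exp,
    show ((Q x).re : ℂ) = Q x from Complex.ext rfl him.symm]

lemma IsExponent.hasDerivAt_profile (hQ : IsExponent φ Q) (hx : x ∈ Set.Ioo (-1 : ℝ) 1) :
    HasDerivAt (profile Q) ((φ x).re * Real.exp (Q x).re) x := by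
  refine ((hasDerivAt_id' x).fun_mul
    (hasDerivAt_re_ofReal hQ.differentiableOn hx).exp).congr_deriv ?_
  linear_combination Real.exp (Q x).re * hQ.mul_re_deriv_ofReal hx

lemma IsExponent.continuousOn_profile (hQ : IsExponent φ Q) :
    ContinuousOn (profile Q) (Set.Ioo (-1) 1) := fun _ hx =>
  (hQ.hasDerivAt_profile hx).continuousAt.continuousWithinAt

lemma IsExponent.strictMonoOn_profile (hQ : IsExponent φ Q) (hre : ∀ z ∈ disk, 0 < (φ z).re) :
    StrictMonoOn (profile Q) (Set.Ioo (-1) 1) := by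
  refine strictMonoOn_of_deriv_pos (convex_Ioo _ _) hQ.continuousOn_profile fun x hx => ?_
  rw [interior_Ioo] at hx
  rw [(hQ.hasDerivAt_profile hx).deriv]
  exact mul_pos (hre _ (ofReal_mem_disk hx)) (Real.exp_pos _)

lemma IsExponent.strictMonoOn_re_ofReal (hφ : DifferentiableOn ℂ φ disk)
    (hinj : Set.InjOn φ disk) (hnn : ∀ n, 0 ≤ taylorCoeff φ n) (hQ : IsExponent φ Q) :
    StrictMonoOn (fun x : ℝ => (Q x).re) (Set.Ioo (-1) 1) := by
  have hmono := MaMinda.strictMonoOn_re_ofReal hφ hinj hnn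
  have h0 : (0 : ℝ) ∈ Set.Ioo (-1 : ℝ) 1 := by norm_num
  have hφ0 : (φ (0 : ℝ)).re = 1 := by rw [Complex.ofReal_zero, hQ.apply_zero, Complex.one_re]
  have hderiv : ∀ x ∈ Set.Ioo (-1 : ℝ) 1, x ≠ 0 → 0 < deriv (fun x : ℝ => (Q x).re) x := by
    intro x hx hx0
    rw [(hasDerivAt_re_ofReal hQ.differentiableOn hx).deriv]
    have hxQ := hQ.mul_re_deriv_ofReal hx
    rcases hx0.lt_or_gt with hneg | hpos
    · have hlt : (φ x).re < 1 := hφ0 ▸ hmono hx h0 hneg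
      exact pos_of_mul_neg_right (hxQ.trans_lt (sub_neg.2 hlt)) hneg.le
    · have hlt : 1 < (φ x).re := hφ0 ▸ hmono h0 hx hpos
      exact pos_of_mul_pos_right (hxQ.symm ▸ sub_pos.2 hlt) hpos.le
  have hcont := continuousOn_re_ofReal hQ.differentiableOn
  rw [← Set.Ioc_union_Ico_eq_Ioo h0.1 h0.2]
  refine StrictMonoOn.union (c := 0) ?_ ?_ (isGreatest_Ioc h0.1) (isLeast_Ico h0.2)
  · refine strictMonoOn_of_deriv_pos (convex_Ioc _ _)
      (hcont.mono (Set.Ioc_subset_Ioo_right h0.2)) fun x hx => ?_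
    rw [interior_Ioc] at hx
    exact hderiv x ⟨hx.1, hx.2.trans h0.2⟩ hx.2.ne
  · refine strictMonoOn_of_deriv_pos (convex_Ico _ _)
      (hcont.mono (Set.Ico_subset_Ioo_left h0.1)) fun x hx => ?_
    rw [interior_Ico] at hx
    exact hderiv x ⟨h0.1.trans hx.1, hx.2⟩ hx.1.ne'

lemma IsExponent.exists_tendsto_neg_profile_neg (hφ : DifferentiableOn ℂ φ disk)
    (hinj : Set.InjOn φ disk) (hre : ∀ z ∈ disk, 0 < (φ z).re) (hnn : ∀ n, 0 ≤ taylorCoeff φ n)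
    (hQ : IsExponent φ Q) :
    ∃ L ∈ Set.Ioc (0 : ℝ) 1, Tendsto (fun r => -profile Q (-r)) (𝓝[<] 1) (𝓝 L) := by
  have hneg {r : ℝ} (hr : r ∈ Set.Ioo (0 : ℝ) 1) : -r ∈ Set.Ioo (-1 : ℝ) 1 :=
    ⟨neg_lt_neg hr.2, by linarith [hr.1]⟩
  have hmono : MonotoneOn (fun r => -profile Q (-r)) (Set.Ioo 0 1) := fun r hr s hs hrs =>
    neg_le_neg ((hQ.strictMonoOn_profile hre).monotoneOn (hneg hs) (hneg hr) (neg_le_neg hrs))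
  have hle : ∀ r ∈ Set.Ioo (0 : ℝ) 1, -profile Q (-r) ≤ 1 := by
    intro r hr
    have hQr := hQ.strictMonoOn_re_ofReal hφ hinj hnn (hneg hr) (by norm_num) (neg_neg_of_pos hr.1)
    simp only [Complex.ofReal_zero, hQ.map_zero, Complex.zero_re] at hQr
    rw [neg_profile_neg]
    exact mul_le_one₀ hr.2.le (Real.exp_pos _).le (Real.exp_le_one_iff.2 hQr.le)
  have hbdd : BddAbove ((fun r => -profile Q (-r)) '' Set.Ioo 0 1) :=
    ⟨1, Set.forall_mem_image.2 hle⟩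
  have hhalf : (1 / 2 : ℝ) ∈ Set.Ioo (0 : ℝ) 1 := by norm_num
  have hpos : 0 < -profile Q (-(1 / 2)) := by
    rw [neg_profile_neg]
    positivity
  exact ⟨sSup ((fun r => -profile Q (-r)) '' Set.Ioo 0 1),
    ⟨hpos.trans_le (le_csSup hbdd ⟨_, hhalf, rfl⟩),
      csSup_le ⟨_, _, hhalf, rfl⟩ (Set.forall_mem_image.2 hle)⟩,
    hmono.tendsto_nhdsWithin_Ioo_left ⟨_, hhalf⟩ hbdd⟩

lemma IsExponent.exists_one_le_profile (hφ : DifferentiableOn ℂ φ disk)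
    (hinj : Set.InjOn φ disk) (hnn : ∀ n, 0 ≤ taylorCoeff φ n) (hQ : IsExponent φ Q) :
    ∃ x ∈ Set.Ioo (0 : ℝ) 1, 1 ≤ profile Q x := by
  have hmono := hQ.strictMonoOn_re_ofReal hφ hinj hnn
  have hhalf : (1 / 2 : ℝ) ∈ Set.Ioo (-1 : ℝ) 1 := by norm_num
  set c := (Q (1 / 2 : ℝ)).re
  have hc : (Q (0 : ℝ)).re < c := hmono (by norm_num) hhalf (by norm_num)
  rw [Complex.ofReal_zero, hQ.map_zero, Complex.zero_re] at hc
  set x := max (1 / 2) (Real.exp (-c))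
  have hx : x ∈ Set.Ioo (0 : ℝ) 1 := ⟨lt_max_of_lt_left (by norm_num),
    max_lt (by norm_num) (Real.exp_lt_one_iff.2 (neg_lt_zero.2 hc))⟩
  refine ⟨x, hx, ?_⟩
  have hcx : c ≤ (Q x).re :=
    hmono.monotoneOn hhalf ⟨by linarith [hx.1], hx.2⟩ (le_max_left _ _)
  calc (1 : ℝ) = Real.exp (-c) * Real.exp c := by rw [← Real.exp_add, neg_add_cancel, Real.exp_zero]
    _ ≤ profile Q x :=
        mul_le_mul (le_max_right _ _) (Real.exp_le_exp.2 hcx) (Real.exp_pos _).le hx.1.le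

lemma IsExponent.exists_profile_eq (hφ : DifferentiableOn ℂ φ disk) (hinj : Set.InjOn φ disk)
    (hnn : ∀ n, 0 ≤ taylorCoeff φ n) (hQ : IsExponent φ Q) (hL : L ∈ Set.Ioc (0 : ℝ) 1) :
    ∃ x ∈ Set.Ioo (0 : ℝ) 1, profile Q x = L := by
  obtain ⟨b, hb, hbL⟩ := hQ.exists_one_le_profile hφ hinj hnn
  have hzero : profile Q 0 = 0 := zero_mul _
  have hcont : ContinuousOn (profile Q) (Set.Icc 0 b) := hQ.continuousOn_profile.mono fun x hx =>
    ⟨by linarith [hx.1], hx.2.trans_lt hb.2⟩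
  obtain ⟨x, hx, rfl⟩ :=
    intermediate_value_Icc hb.1.le hcont ⟨hzero.trans_le hL.1.le, hL.2.trans hbL⟩
  refine ⟨x, ⟨hx.1.lt_of_ne fun h0 => hL.1.ne' ?_, hx.2.trans_lt hb.2⟩, rfl⟩
  rw [← h0, hzero]

lemma IsExponent.isLeast_root (hre : ∀ z ∈ disk, 0 < (φ z).re) (hnn : ∀ n, 0 ≤ taylorCoeff φ n)
    (hQ : IsExponent φ Q) (hx : x ∈ Set.Ioo (0 : ℝ) 1) :
    IsLeast {r : ℝ | 0 < r ∧ r < 1 ∧ r * Complex.exp (Q r) + (-profile Q x : ℝ) = 0} x := by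
  have hroot {r : ℝ} (hr0 : 0 < r) (hr1 : r < 1) :
      r * Complex.exp (Q r) + (-profile Q x : ℝ) = 0 ↔ r = x := by
    have hr : r ∈ Set.Ioo (-1 : ℝ) 1 := ⟨by linarith, hr1⟩
    rw [← hQ.ofReal_profile hnn hr, Complex.ofReal_neg, add_neg_eq_zero, Complex.ofReal_inj,
      (hQ.strictMonoOn_profile hre).injOn.eq_iff hr ⟨by linarith [hx.1], hx.2⟩]
  exact ⟨⟨hx.1, hx.2, (hroot hx.1 hx.2).2 rfl⟩, fun r hr => ((hroot hr.1 hr.2.1).1 hr.2.2).ge⟩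

lemma IsExponent.tendsto_neg_one (hnn : ∀ n, 0 ≤ taylorCoeff φ n) (hQ : IsExponent φ Q)
    (hL : Tendsto (fun r => -profile Q (-r)) (𝓝[<] 1) (𝓝 L)) :
    Tendsto (fun r : ℝ => -(r : ℂ) * Complex.exp (Q (-(r : ℂ)))) (𝓝[<] 1) (𝓝 (-L : ℝ)) := by
  refine ((Complex.continuous_ofReal.tendsto _).comp hL.neg).congr' ?_
  filter_upwards [Ioo_mem_nhdsLT (zero_lt_one' ℝ)] with r hr
  have hneg : -r ∈ Set.Ioo (-1 : ℝ) 1 := ⟨neg_lt_neg hr.2, by linarith [hr.1]⟩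
  simpa using hQ.ofReal_profile hnn hneg

lemma IsExponent.add_tsum_majorantTerm_le (hφ : DifferentiableOn ℂ φ disk)
    (hnn : ∀ n, 0 ≤ taylorCoeff φ n) (hQ : IsExponent φ Q) (hf : f ∈ StarlikeClass φ) {r : ℝ}
    (hr0 : 0 ≤ r) (hr3 : r ≤ 1 / 3) :
    Summable (majorantTerm f r) ∧ r + ∑' n, majorantTerm f r n ≤ profile Q r := by
  obtain ⟨ω, q, hω, hq, hfq⟩ := exists_isExponent_of_mem_starlikeClass hφ hQ.apply_zero hf
  have hnonneg : ∀ n, 0 ≤ majorantTerm f r n := fun n => by rw [majorantTerm]; positivity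
  have hpartial : ∀ N, ∑ n ∈ Finset.range N, majorantTerm f r n ≤ profile Q r - r := by
    intro N
    rw [le_sub_iff_add_le', ← hf.1.majorantSum_add_two,
      majorantSum_of_eqOn_mul_exp hq.differentiableOn hfq]
    exact mul_le_mul_of_nonneg_left (hQ.majorantSum_exp_le hφ hnn hω hq hr0 hr3 N) hr0
  exact ⟨summable_of_sum_range_le hnonneg hpartial,
    le_sub_iff_add_le'.1 (Real.tsum_le_of_sum_range_le hnonneg hpartial)⟩

lemma IsExponent.le_boundaryDist (hφ : DifferentiableOn ℂ φ disk) (hinj : Set.InjOn φ disk)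
    (hre : ∀ z ∈ disk, 0 < (φ z).re) (hnn : ∀ n, 0 ≤ taylorCoeff φ n) (hQ : IsExponent φ Q)
    (hf : f ∈ StarlikeClass φ) (hL : Tendsto (fun r => -profile Q (-r)) (𝓝[<] 1) (𝓝 L)) :
    L ≤ boundaryDist f := by
  obtain ⟨ω, q, hω, hq, hfq⟩ := exists_isExponent_of_mem_starlikeClass hφ hQ.apply_zero hf
  have hd : ∀ z ∈ disk, deriv f z ≠ 0 := fun z hz =>
    hq.deriv_ne_zero hfq hz (Complex.ne_zero_of_re_pos (hre _ (hω.mapsTo hz)))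
  refine MaMinda.le_boundaryDist hf.1.analytic hf.1.univalent hd hL fun z hz => ?_
  rw [neg_profile_neg, hf.1.map_zero, dist_zero_left, hfq hz, norm_mul, Complex.norm_exp]
  exact mul_le_mul_of_nonneg_left
    (Real.exp_le_exp.2 (hQ.re_neg_norm_le hφ hinj hnn hω hq hz)) (norm_nonneg z)

lemma IsExponent.boundaryDist_le (hre : ∀ z ∈ disk, 0 < (φ z).re)
    (hnn : ∀ n, 0 ≤ taylorCoeff φ n) (hQ : IsExponent φ Q) (hL0 : 0 ≤ L)
    (hL : Tendsto (fun r => -profile Q (-r)) (𝓝[<] 1) (𝓝 L)) :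
    boundaryDist (fun z => z * Complex.exp (Q z)) ≤ L := by
  have hS := (hQ.isExtremal hre).1
  have hd : ∀ z ∈ disk, deriv (fun z => z * Complex.exp (Q z)) z ≠ 0 := fun z hz =>
    hQ.deriv_ne_zero (Set.eqOn_refl _ _) hz (Complex.ne_zero_of_re_pos (hre z hz))
  have hnorm : Tendsto (fun r : ℝ => ‖-(r : ℂ)‖) (𝓝[<] 1) (𝓝[<] 1) := by
    refine tendsto_id.congr' ?_
    filter_upwards [Ioo_mem_nhdsLT (zero_lt_one' ℝ)] with r hr
    rw [norm_neg, Complex.norm_real, Real.norm_of_nonneg hr.1.le, id]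
  have hle := boundaryDist_le_of_tendsto hS.analytic hS.univalent hd hnorm
    (hQ.tendsto_neg_one hnn hL)
  rwa [zero_mul, dist_zero_left, Complex.norm_real, norm_neg, Real.norm_of_nonneg hL0] at hle

lemma IsExponent.hasSum_majorantTerm (hre : ∀ z ∈ disk, 0 < (φ z).re)
    (hnn : ∀ n, 0 ≤ taylorCoeff φ n) (hQ : IsExponent φ Q) (hx : x ∈ Set.Ioo (-1 : ℝ) 1) :
    HasSum (majorantTerm (fun z => z * Complex.exp (Q z)) x) (profile Q x - x) := by
  have hsum := (hQ.isExtremal hre).1.hasSum_majorantTerm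
    (taylorCoeff_id_mul_exp_nonneg hQ.differentiableOn hQ.map_zero (hQ.taylorCoeff_nonneg hnn)) hx
  rwa [← hQ.ofReal_profile hnn hx, Complex.ofReal_re] at hsum

end

lemma IsExtremal.mem_starlikeClass {φ h : ℂ → ℂ} (hh : IsExtremal φ h) : h ∈ StarlikeClass φ :=
  ⟨hh.1, _, IsSchwarz.id.differentiableOn, IsSchwarz.id.mapsTo, rfl, hh.2⟩

lemma IsMaMinda.taylorCoeff_nonneg {φ : ℂ → ℂ} (hφ : IsMaMinda φ)
    (hpos : ∀ n : ℕ, 1 ≤ n → 0 < (taylorCoeff φ n).re ∧ (taylorCoeff φ n).im = 0) (n : ℕ) :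
    0 ≤ taylorCoeff φ n := by
  rcases n with _ | n
  · rw [taylorCoeff_zero, hφ.map_zero]
    exact zero_le_one
  · have hn := hpos (n + 1) n.succ_pos
    exact Complex.nonneg_iff.2 ⟨hn.1.le, hn.2.symm⟩

end MaMinda

open MaMinda ComplexOrder in
theorem theorem2p1_general {φ : ℂ → ℂ} (hφ : DifferentiableOn ℂ φ disk) (hinj : Set.InjOn φ disk)
    (hre : ∀ z ∈ disk, 0 < (φ z).re) (h1 : φ 0 = 1) (hnn : ∀ n, 0 ≤ taylorCoeff φ n) :
    ∃ h : ℂ → ℂ, IsExtremal φ h ∧ (∀ g : ℂ → ℂ, IsExtremal φ g → Set.EqOn g h disk) ∧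
      ∃ (m : ℂ) (rf : ℝ),
        Tendsto (fun r : ℝ => h (-(r : ℂ))) (𝓝[<] 1) (𝓝 m) ∧
        IsLeast {r : ℝ | 0 < r ∧ r < 1 ∧ h (r : ℂ) + m = 0} rf ∧
        (∀ f ∈ StarlikeClass φ, ∀ r : ℝ, 0 ≤ r → r ≤ min rf (1 / 3) →
          Summable (majorantTerm f r) ∧ r + ∑' n, majorantTerm f r n ≤ boundaryDist f) ∧
        ∀ r : ℝ, rf < r → r < 1 →
          ∃ f ∈ StarlikeClass φ,
            Summable (majorantTerm f r) ∧ boundaryDist f < r + ∑' n, majorantTerm f r n := by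
  obtain ⟨Q, hQ⟩ := exists_isExponent hφ h1
  have hext := hQ.isExtremal hre
  have hmono := hQ.strictMonoOn_profile hre
  obtain ⟨L, hL, hlim⟩ := hQ.exists_tendsto_neg_profile_neg hφ hinj hre hnn
  obtain ⟨rf, hrf, rfl⟩ := hQ.exists_profile_eq hφ hinj hnn hL
  have hrf' : rf ∈ Set.Ioo (-1 : ℝ) 1 := ⟨by linarith [hrf.1], hrf.2⟩
  refine ⟨fun z => z * Complex.exp (Q z), hext, fun g hg => hQ.eqOn_of_isExtremal hg, _, rf,
    hQ.tendsto_neg_one hnn hlim, hQ.isLeast_root hre hnn hrf, fun f hf r hr0 hr => ?_,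
    fun r hrf_lt hr1 => ?_⟩
  · obtain ⟨hrrf, hr3⟩ := le_min_iff.1 hr
    obtain ⟨hsum, hle⟩ := hQ.add_tsum_majorantTerm_le hφ hnn hf hr0 hr3
    refine ⟨hsum, hle.trans ?_⟩
    calc profile Q r ≤ profile Q rf :=
          hmono.monotoneOn ⟨by linarith, hrrf.trans_lt hrf.2⟩ hrf' hrrf
      _ ≤ boundaryDist f := hQ.le_boundaryDist hφ hinj hre hnn hf hlim
  · have hr : r ∈ Set.Ioo (-1 : ℝ) 1 := ⟨hrf'.1.trans hrf_lt, hr1⟩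
    have hsum := hQ.hasSum_majorantTerm hre hnn hr
    refine ⟨_, hext.mem_starlikeClass, hsum.summable, ?_⟩
    rw [hsum.tsum_eq, add_sub_cancel]
    exact (hQ.boundaryDist_le hre hnn hL.1.le hlim).trans_lt (hmono hrf' hr hrf_lt)

open MaMinda in
theorem theorem2p1 (φ : ℂ → ℂ) (hφ : IsMaMinda φ)
    (hpos : ∀ n : ℕ, 1 ≤ n → 0 < (taylorCoeff φ n).re ∧ (taylorCoeff φ n).im = 0)
    (hH2 : MemHardyTwo φ) :
    ∃ h : ℂ → ℂ, IsExtremal φ h ∧ (∀ g : ℂ → ℂ, IsExtremal φ g → Set.EqOn g h disk) ∧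
      ∃ (m : ℂ) (rf : ℝ),
        -- `m` is the radial limit `h(-1)`
        Tendsto (fun r : ℝ => h (-(r : ℂ))) (𝓝[<] 1) (𝓝 m) ∧
        IsLeast {r : ℝ | 0 < r ∧ r < 1 ∧ h (r : ℂ) + m = 0} rf ∧
        (∀ f ∈ StarlikeClass φ, ∀ r : ℝ, 0 ≤ r → r ≤ min rf (1 / 3) →
          Summable (majorantTerm f r) ∧ r + ∑' n, majorantTerm f r n ≤ boundaryDist f) ∧
        -- sharpness
        (rf ≤ 1 / 3 → ∀ r : ℝ, rf < r → r < 1 →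
          ∃ f ∈ StarlikeClass φ,
            Summable (majorantTerm f r) ∧ boundaryDist f < r + ∑' n, majorantTerm f r n) := by
  obtain ⟨h, hext, huniq, m, rf, hlim, hroot, hbohr, hsharp⟩ := theorem2p1_general hφ.analytic
    hφ.univalent hφ.re_pos hφ.map_zero (hφ.taylorCoeff_nonneg hpos)
  exact ⟨h, hext, huniq, m, rf, hlim, hroot, hbohr, fun _ => hsharp⟩
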